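/- Let $d\in\mathbb N$, $\mathbb R_+^d=\{x\in\mathbb R^d: x_1,\dots,x_d\ge 0\}$, and let $(c,\beta,B,\nu,\mu)$ be admissible parameters of a conservative multi-type CBI process on $\mathbb R_+^d$: $c,\beta\in\mathbb R_+^d$; $B=(b_{ij})\in\mathbb R^{d\times d}$ with $b_{ij}\ge 0$ for $i\ne j$; $\nu$ is a Borel measure on $\mathbb R_+^d$ with $\nu(\{0\})=0$ and $\int(1\wedge|z|)\,\nu(dz)<\infty$; $\mu=(\mu_1,\dots,\mu_d)$ with Borel measures $\mu_i$ on $\mathbb R_+^d$ such that $\mu_i(\{0\})=0$ and $\int\big(|z|\wedge|z|^2+\sum_{j\ne i}(1\wedge z_j)\big)\mu_i(dz)<\infty$. For $x\in\mathbb R^d$ let $g_t^x$ denote the distribution at time $t\geq 0$ of a Lévy process $L^x$ on $\mathbb R^d$ with $\mathbb E[e^{i\lambda\cdot L^x(t)}]=e^{-t\Psi_x(\lambda)}$, where $$\Psi_x(\lambda)=\sum_{j=1}^d 2c_jx_j\mathbf 1_{\mathbb R_+}(x_j)\lambda_j^2+\int_{\mathbb R_+^d}(1-e^{i\lambda\cdot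 z})\,\nu(dz)+\sum_{j=1}^d x_j\mathbf 1_{\mathbb R_+}(x_j)\int_{|z|\le1}(1+i\lambda\cdot z-e^{i\lambda\cdot z})\,\mu_j(dz).$$ For $I\subset\{1,\dots,d\}$ and $\alpha_1,\dots,\alpha_d\in(0,2]$ put $\rho_I(x)=\min\{x_j^{1/\alpha_j}: j\in I\}\,\mathbf 1_{\mathbb R_+^d}(x)$, $\rho_\emptyset=\mathbf 1_{\mathbb R_+^d}$, and $\Gamma(I)=\{x\in\mathbb R^d:\rho_I(x)>0\}$. Condition (A) holds for $I$ and $\alpha_1,\dots,\alpha_d$ if there are constants $C,t_0>0$ such that for all $x\in\Gamma(I)$ and $t\in(0,t_0)$ the distribution $g_t^x$ has a density with respect to Lebesgue measure, also denoted by $g_t^x$, with $$\int_{\mathbb R^d}|g_t^x(z+he_i)-g_t^x(z)|\,dz\le\frac{C|h|}{\rho_I(x)}\,t^{-1/\alpha_i},\qquad h\in[-1,1],\ i\in\{1,\dots,d\},$$ where $e_1,\dots,e_d$ is the canonical basis of $\mathbb R^d$. **Lemma.** Suppose that there exist $\alpha\in(0,1)$ and constants $c',C',R>0$ such that $$c'|\lambda|^\alpha\le\int_{\mathbb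 R_+^d}\big(1-\cos(\lambda\cdot z)\big)\,\nu(dz)\le C'|\lambda|^\alpha\qquad\text{for all }\lambda\in\mathbb R^d\text{ with }|\lambda|\ge R.$$ Then condition (A) holds for $I=\emptyset$ and $\alpha_1=\dots=\alpha_d=\alpha$. -/

import Mathlib

open MeasureTheory ProbabilityTheory Filter Topology
open scoped NNReal ENNReal

universe u

namespace CBI

/-- The orthant `ℝ₊ᵈ` of vectors with nonnegative coordinates. -/
def orthant (d : ℕ) : Set (EuclideanSpace ℝ (Fin d)) := {x | ∀ j, 0 ≤ x j}

/-- Admissible parameters `(c, β, B, ν, μ)` of a conservative multi-type CBI process on `ℝ₊ᵈ`.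
Borel measures on `ℝ₊ᵈ` are Borel measures on `ℝᵈ` that do not charge the complement of `ℝ₊ᵈ`. -/
structure AdmissibleParams (d : ℕ) where
  c : Fin d → ℝ
  c_nonneg : ∀ i, 0 ≤ c i
  β : Fin d → ℝ
  β_nonneg : ∀ i, 0 ≤ β i
  B : Matrix (Fin d) (Fin d) ℝ
  B_nonneg : ∀ i j, i ≠ j → 0 ≤ B i j
  ν : Measure (EuclideanSpace ℝ (Fin d))
  ν_compl_orthant : ν (orthant d)ᶜ = 0
  ν_zero : ν {0} = 0
  ν_integrable : Integrable (fun z => min 1 ‖z‖) ν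
  μ : Fin d → Measure (EuclideanSpace ℝ (Fin d))
  μ_compl_orthant : ∀ i, μ i (orthant d)ᶜ = 0
  μ_zero : ∀ i, μ i {0} = 0
  μ_integrable : ∀ i, Integrable
    (fun z => min ‖z‖ (‖z‖ ^ 2) + ∑ j ∈ Finset.univ.erase i, min 1 (z j)) (μ i)

/-- The symbol `Ψ_x(ξ)` of the noise; `max (x j) 0` is `x_j 1_{ℝ₊}(x_j)`. -/
noncomputable def symbol {d : ℕ} (p : AdmissibleParams d) (x ξ : EuclideanSpace ℝ (Fin d)) : ℂ :=
  (∑ j, ((2 * p.c j * max (x j) 0 * ξ j ^ 2 : ℝ) : ℂ))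
    + ∫ z in orthant d, (1 - Complex.exp (Complex.I * (inner ℝ ξ z : ℂ))) ∂p.ν
    + ∑ j, ((max (x j) 0 : ℝ) : ℂ) *
        ∫ z in {z | ‖z‖ ≤ 1},
          (1 + Complex.I * (inner ℝ ξ z : ℂ) - Complex.exp (Complex.I * (inner ℝ ξ z : ℂ))) ∂p.μ j

/-- Lévy processes on `ℝᵈ`: started at `0`, with independent and stationary increments and
almost surely càdlàg paths. -/
structure IsLevyProcess {d : ℕ} {Ω : Type u} [MeasurableSpace Ω] (P : Measure Ω)
    (L : ℝ≥0 → Ω → EuclideanSpace ℝ (Fin d)) : Prop where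
  isProbabilityMeasure : IsProbabilityMeasure P
  measurable : ∀ t, Measurable (L t)
  zero : ∀ᵐ ω ∂P, L 0 ω = 0
  indep_increments : HasIndepIncrements L P
  stationary_increments : ∀ s t, P.map (fun ω => L (s + t) ω - L s ω) = P.map (L t)
  cadlag : ∀ᵐ ω ∂P, ∀ t, ContinuousWithinAt (fun s => L s ω) (Set.Ici t) t ∧
    ∃ l, Tendsto (fun s => L s ω) (𝓝[<] t) (𝓝 l)

/-- `L` is (a version of) the Lévy process `L^x`, that is, `E[exp(i ξ · L(t))] = exp(-t Ψ_x(ξ))`. -/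
structure IsNoiseProcess {d : ℕ} (p : AdmissibleParams d) (x : EuclideanSpace ℝ (Fin d))
    {Ω : Type u} [MeasurableSpace Ω] (P : Measure Ω)
    (L : ℝ≥0 → Ω → EuclideanSpace ℝ (Fin d)) : Prop where
  isLevyProcess : IsLevyProcess P L
  charFun_eq : ∀ (t : ℝ≥0) (ξ : EuclideanSpace ℝ (Fin d)),
    ∫ ω, Complex.exp (Complex.I * (inner ℝ ξ (L t ω) : ℂ)) ∂P = Complex.exp (-((t : ℝ) : ℂ) * symbol p x ξ)

/-- `g` is a density of `g_t^x`, the distribution of `L^x(t)`: the measure `g(z) dz` is the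
probability measure with characteristic function `exp(-t Ψ_x)` (so that this distribution exists),
and it is the law at time `t` of every Lévy process with symbol `Ψ_x`. -/
structure IsNoiseDensity {d : ℕ} (p : AdmissibleParams d) (x : EuclideanSpace ℝ (Fin d)) (t : ℝ≥0)
    (g : EuclideanSpace ℝ (Fin d) → ℝ) : Prop where
  measurable : Measurable g
  nonneg : ∀ z, 0 ≤ g z
  isProbabilityMeasure : IsProbabilityMeasure (volume.withDensity fun z => ENNReal.ofReal (g z))
  charFun_eq : ∀ ξ, charFun (volume.withDensity fun z => ENNReal.ofReal (g z)) ξ =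
    Complex.exp (-((t : ℝ) : ℂ) * symbol p x ξ)
  law_eq : ∀ (Ω : Type u) [MeasurableSpace Ω] (P : Measure Ω)
    (L : ℝ≥0 → Ω → EuclideanSpace ℝ (Fin d)), IsNoiseProcess p x P L →
      P.map (L t) = volume.withDensity fun z => ENNReal.ofReal (g z)

open Classical in
/-- `ρ_I(x) = min {x_j ^ (1/α_j) | j ∈ I} 1_{ℝ₊ᵈ}(x)`, with `ρ_∅ = 1_{ℝ₊ᵈ}`. -/
noncomputable def rho {d : ℕ} (I : Finset (Fin d)) (α : Fin d → ℝ)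
    (x : EuclideanSpace ℝ (Fin d)) : ℝ :=
  if x ∈ orthant d then
    if h : I.Nonempty then I.inf' h (fun j => x j ^ (1 / α j)) else 1
  else 0

/-- `Γ(I)`. -/
def Gam {d : ℕ} (I : Finset (Fin d)) (α : Fin d → ℝ) : Set (EuclideanSpace ℝ (Fin d)) :=
  {x | 0 < rho I α x}

/-- Condition (A) for the index set `I` and the exponents `α_1, …, α_d`. -/
def ConditionA {d : ℕ} (p : AdmissibleParams d) (I : Finset (Fin d)) (α : Fin d → ℝ) : Prop :=
  (∀ i, 0 < α i ∧ α i ≤ 2) ∧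
  ∃ C : ℝ, 0 < C ∧ ∃ t₀ : ℝ≥0, 0 < t₀ ∧
    ∀ x ∈ Gam I α, ∀ t : ℝ≥0, 0 < t → t < t₀ →
      ∃ g : EuclideanSpace ℝ (Fin d) → ℝ, IsNoiseDensity.{u} p x t g ∧
        ∀ i : Fin d, ∀ h ∈ Set.Icc (-1 : ℝ) 1,
          ∫ z, |g (z + h • EuclideanSpace.single i (1 : ℝ)) - g z| ≤
            C * |h| / rho I α x * (t : ℝ) ^ (-(1 / α i))

end CBI

/-! The law of the noise at time `t` is a convolution of three laws: the jump part with Lévy measure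
`t ν`, a Gaussian, and compensated small jumps from the `μ j`. Only the last two depend on `x`.
Convolution with a probability measure cannot increase the `L¹` modulus of continuity of a density
(`exists_density_conv`), so an estimate for the `ν` part alone is automatically uniform in `x`.

Put `s = t ^ (-1/α)`. Fourier inversion and the lower bound on the symbol give the `ν` law `Q` a
density `f` of size `s ^ d` with Lipschitz constant of order `s ^ (d + 1)`. These are sup bounds,
and `f` may have heavy tails, so they do not give an `L¹` bound directly. Positivity of the jumps
provides the missing localization: `Q` lives on the orthant, where `exp (-s ∑ z_j)` has mass `s ^
(-d)`. The normalized tilt `P = M exp (-s ∑ z_j) Q` has Lévy measure `t exp (-s ∑ z_j) ν`, hence `Q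
= P ∗ S`, where `S` has Lévy measure `t (1 - exp (-s ∑ z_j)) ν` (`exists_tilt_factorization`). The
powers of `s` combine to an `L¹` modulus of order `s |h|` for `P` (`exists_tilted_density`), and
convolution passes it on to the noise.

The constant is uniform in `t` provided that `M = exp (t ∫ (1 - exp (-s ∑ z_j)) dν)` is bounded.
This is where the upper bound on the symbol enters: averaging it over dilations of the frequency
bounds `∫ min 1 (s ∑ z_j) dν` by a multiple of `s ^ α = 1 / t` (`lintegral_min_one_inner_le`). -/

namespace CBI

/-! ### Weak limits, convolution powers and compound Poisson laws. -/

section Laws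

variable {V : Type*} [NormedAddCommGroup V] [InnerProductSpace ℝ V] [FiniteDimensional ℝ V]
  [MeasurableSpace V] [BorelSpace V]

open BoundedContinuousFunction in
/-- **Lévy's continuity theorem**, including the existence of the limit law. -/
theorem exists_tendsto_of_tendsto_charFun {μ : ℕ → ProbabilityMeasure V} {f : V → ℂ}
    (hf : ContinuousAt f 0)
    (h : ∀ ξ, Tendsto (fun n => charFun (μ n : Measure V) ξ) atTop (𝓝 (f ξ))) :
    ∃ μ₀ : ProbabilityMeasure V, (∀ ξ, charFun (μ₀ : Measure V) ξ = f ξ) ∧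
      Tendsto μ atTop (𝓝 μ₀) := by
  have h_tight : IsTightMeasureSet (Set.range fun n => (μ n : Measure V)) :=
    isTightMeasureSet_of_tendsto_charFun hf h
  have h_compact : IsCompact (closure (Set.range μ)) := by
    refine isCompact_closure_of_isTightMeasureSet (h_tight.subset ?_)
    rintro _ ⟨_, ⟨n, rfl⟩, rfl⟩
    exact ⟨n, rfl⟩
  -- A limit along one nonprincipal ultrafilter suffices: its characteristic function must be `f`,
  -- and then the whole sequence converges to it.
  obtain ⟨μ₀, -, hμ₀⟩ := h_compact.ultrafilter_le_nhds ((hyperfilter ℕ).map μ) <| by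
    rw [le_principal_iff]
    exact Filter.mem_map.2 (Filter.Eventually.of_forall fun n => subset_closure ⟨n, rfl⟩)
  have hμ₀' : Tendsto μ (hyperfilter ℕ) (𝓝 μ₀) := hμ₀
  have hchar : ∀ ξ, charFun (μ₀ : Measure V) ξ = f ξ := by
    intro ξ
    rw [ProbabilityMeasure.tendsto_iff_forall_integral_rclike_tendsto ℂ] at hμ₀'
    have h1 := hμ₀' (innerProbChar ξ)
    simp_rw [← charFun_eq_integral_innerProbChar] at h1
    exact tendsto_nhds_unique h1 ((h ξ).mono_left Nat.hyperfilter_le_atTop)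
  refine ⟨μ₀, hchar, ProbabilityMeasure.tendsto_of_tendsto_charFun fun ξ => ?_⟩
  rw [hchar]
  exact h ξ

/-- A bounded continuous function that is multiplicative on `K`. -/
def IsCharOn (K : AddSubmonoid V) (χ : BoundedContinuousFunction V ℂ) : Prop :=
  χ 0 = 1 ∧ ∀ x ∈ K, ∀ y ∈ K, χ (x + y) = χ x * χ y

omit [FiniteDimensional ℝ V] [MeasurableSpace V] [BorelSpace V] in
theorem isCharOn_innerProbChar (K : AddSubmonoid V) (ξ : V) :
    IsCharOn K (BoundedContinuousFunction.innerProbChar ξ) := by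
  refine ⟨?_, fun x _ y _ => ?_⟩
  · simp [BoundedContinuousFunction.innerProbChar_apply]
  · simp only [BoundedContinuousFunction.innerProbChar_apply, inner_add_left, ← Complex.exp_add]
    push_cast
    ring_nf

/-- Lévy's continuity theorem for laws carried by a closed set. -/
theorem exists_tendsto_integral_of_tendsto_charFun {K : Set V} (hK : IsClosed K)
    {μ : ℕ → Measure V} (hμ : ∀ n, IsProbabilityMeasure (μ n)) (hμK : ∀ n, μ n Kᶜ = 0)
    {f : V → ℂ} (hf : ContinuousAt f 0)
    (h : ∀ ξ, Tendsto (fun n => charFun (μ n) ξ) atTop (𝓝 (f ξ))) :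
    ∃ Q : Measure V, IsProbabilityMeasure Q ∧ Q Kᶜ = 0 ∧ (∀ ξ, charFun Q ξ = f ξ) ∧
      ∀ χ : BoundedContinuousFunction V ℂ,
        Tendsto (fun n => ∫ z, χ z ∂μ n) atTop (𝓝 (∫ z, χ z ∂Q)) := by
  obtain ⟨Q, hQ, hlim⟩ :=
    exists_tendsto_of_tendsto_charFun (μ := fun n => ⟨μ n, hμ n⟩) hf h
  refine ⟨Q, inferInstance, ?_, hQ, fun χ => ?_⟩
  · have h1 : (Q : Measure V) Kᶜ ≤ liminf (fun n => μ n Kᶜ) atTop :=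
      ProbabilityMeasure.le_liminf_measure_open_of_tendsto hlim hK.isOpen_compl
    simpa [hμK] using h1
  · exact (ProbabilityMeasure.tendsto_iff_forall_integral_rclike_tendsto ℂ).1 hlim χ

theorem conv_compl_eq_zero {K : AddSubmonoid V} (hK : IsClosed (K : Set V)) {P Q : Measure V}
    [SFinite P] [SFinite Q] (hP : P (K : Set V)ᶜ = 0) (hQ : Q (K : Set V)ᶜ = 0) :
    (P ∗ Q) (K : Set V)ᶜ = 0 := by
  have h : ∀ᵐ x ∂P, ∀ᵐ y ∂Q, x + y ∈ K := by
    filter_upwards [mem_ae_iff.2 hP] with x hx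
    filter_upwards [mem_ae_iff.2 hQ] with y hy using K.add_mem hx hy
  have hm : MeasurableSet (K : Set V)ᶜ := hK.measurableSet.compl
  rw [Measure.conv, Measure.map_apply (by fun_prop) hm,
    Measure.measure_prod_null (hm.preimage (by fun_prop))]
  filter_upwards [h] with x hx
  exact mem_ae_iff.1 hx

/-- Multiplicativity is required only where the laws live. This lets Fourier characters and
exponential tilts on the orthant be treated together, at the price of tracking supports. -/
theorem integral_conv_of_isCharOn {K : AddSubmonoid V} {χ : BoundedContinuousFunction V ℂ}
    (hχ : IsCharOn K χ) {P Q : Measure V} [IsFiniteMeasure P] [IsFiniteMeasure Q]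
    (hP : P (K : Set V)ᶜ = 0) (hQ : Q (K : Set V)ᶜ = 0) :
    ∫ z, χ z ∂(P ∗ Q) = (∫ z, χ z ∂P) * ∫ z, χ z ∂Q := by
  rw [integral_conv (χ.integrable _), ← integral_mul_const]
  refine integral_congr_ae ?_
  filter_upwards [mem_ae_iff.2 hP] with x hx
  rw [← integral_const_mul]
  refine integral_congr_ae ?_
  filter_upwards [mem_ae_iff.2 hQ] with y hy using hχ.2 x hx y hy

theorem exists_convolution_power {K : AddSubmonoid V} (hK : IsClosed (K : Set V)) {P : Measure V}
    [IsProbabilityMeasure P] (hP : P (K : Set V)ᶜ = 0) (n : ℕ) :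
    ∃ Q : Measure V, IsProbabilityMeasure Q ∧ Q (K : Set V)ᶜ = 0 ∧
      ∀ χ : BoundedContinuousFunction V ℂ, IsCharOn K χ → ∫ z, χ z ∂Q = (∫ z, χ z ∂P) ^ n := by
  induction n with
  | zero =>
    refine ⟨Measure.dirac 0, inferInstance, ?_, fun χ hχ => ?_⟩
    · rw [Measure.dirac_apply' _ hK.measurableSet.compl]
      simp
    · simp [hχ.1]
  | succ n ih =>
    obtain ⟨Q, hQ, hQK, h⟩ := ih
    refine ⟨Q ∗ P, inferInstance, conv_compl_eq_zero hK hQK hP, fun χ hχ => ?_⟩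
    rw [integral_conv_of_isCharOn hχ hQK hP, h χ hχ, pow_succ]

/-- Existence of compound Poisson laws. -/
theorem exists_compoundPoisson {K : AddSubmonoid V} (hK : IsClosed (K : Set V)) (m : Measure V)
    [IsFiniteMeasure m] (hm : m (K : Set V)ᶜ = 0) :
    ∃ Q : Measure V, IsProbabilityMeasure Q ∧ Q (K : Set V)ᶜ = 0 ∧
      ∀ χ : BoundedContinuousFunction V ℂ, IsCharOn K χ →
        ∫ z, χ z ∂Q = Complex.exp (∫ z, (χ z - 1) ∂m) := by
  -- The index is shifted by `N` so that the weight `1 - m(V)/k` of the Dirac mass below is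
  -- nonnegative for every `k = n + N + 1`. The `k`-fold convolution powers then integrate `χ` to
  -- `(1 + a/k) ^ k`, which tends to `exp a`.
  obtain ⟨N, hN⟩ := exists_nat_gt (m.real Set.univ)
  have hstep : ∀ n : ℕ, ∃ P : Measure V, IsProbabilityMeasure P ∧ P (K : Set V)ᶜ = 0 ∧
      ∀ χ : BoundedContinuousFunction V ℂ, IsCharOn K χ →
        ∫ z, χ z ∂P = 1 + (∫ z, (χ z - 1) ∂m) / ((n + N + 1 : ℕ) : ℂ) := by
    intro n
    set k : ℝ := ((n + N + 1 : ℕ) : ℝ) with hk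
    have hk0 : 0 < k := by positivity
    have hmk : m.real Set.univ ≤ k := by
      rw [hk]; push_cast; linarith [(Nat.cast_nonneg n : (0 : ℝ) ≤ n)]
    have h0 : 0 ≤ 1 - m.real Set.univ / k := by
      rw [sub_nonneg, div_le_one hk0]; exact hmk
    set P : Measure V := ENNReal.ofReal (1 - m.real Set.univ / k) • Measure.dirac 0 +
      ENNReal.ofReal (1 / k) • m with hPdef
    have hfin1 : IsFiniteMeasure (ENNReal.ofReal (1 - m.real Set.univ / k) • Measure.dirac (0 : V)) :=
      Measure.smul_finite _ ENNReal.ofReal_ne_top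
    have hfin2 : IsFiniteMeasure (ENNReal.ofReal (1 / k) • m) :=
      Measure.smul_finite _ ENNReal.ofReal_ne_top
    refine ⟨P, ⟨?_⟩, ?_, fun χ hχ => ?_⟩
    · rw [hPdef]
      simp only [Measure.coe_add, Measure.coe_smul, Pi.add_apply, Pi.smul_apply, smul_eq_mul,
        measure_univ, mul_one]
      rw [← ofReal_measureReal (μ := m), ← ENNReal.ofReal_mul (by positivity),
        ← ENNReal.ofReal_add h0 (by positivity), ← ENNReal.ofReal_one]
      congr 1
      ring
    · rw [hPdef]
      simp only [Measure.coe_add, Measure.coe_smul, Pi.add_apply, Pi.smul_apply, smul_eq_mul, hm]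
      rw [Measure.dirac_apply' _ hK.measurableSet.compl]
      simp
    · rw [hPdef, integral_add_measure (χ.integrable _) (χ.integrable _), integral_smul_measure,
        integral_smul_measure, integral_dirac, hχ.1, integral_sub (χ.integrable _) (integrable_const _),
        integral_const, ENNReal.toReal_ofReal h0, ENNReal.toReal_ofReal (by positivity)]
      have hkc : ((n + N + 1 : ℕ) : ℂ) = (k : ℂ) := by rw [hk]; push_cast; ring
      rw [hkc]
      simp only [Complex.real_smul]
      push_cast
      ring
  choose P hP hPK hPχ using hstep
  choose Q hQ hQK hQχ using fun n => exists_convolution_power (P := P n) hK (hPK n) (n + N + 1)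
  have hlim : ∀ χ : BoundedContinuousFunction V ℂ, IsCharOn K χ →
      Tendsto (fun n => ∫ z, χ z ∂Q n) atTop (𝓝 (Complex.exp (∫ z, (χ z - 1) ∂m))) := by
    intro χ hχ
    have h1 := (Complex.tendsto_one_add_div_pow_exp (∫ z, (χ z - 1) ∂m)).comp
      (tendsto_add_atTop_nat (N + 1))
    refine h1.congr fun n => ?_
    simp only [Function.comp_apply, hQχ n χ hχ, hPχ n χ hχ, add_assoc]
  have hcont : Continuous fun ξ : V =>
      Complex.exp (∫ z, (BoundedContinuousFunction.innerProbChar ξ z - 1) ∂m) := by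
    have : (fun ξ : V => ∫ z, (BoundedContinuousFunction.innerProbChar ξ z - 1) ∂m) =
        fun ξ => charFun m ξ - m.real Set.univ := by
      ext ξ
      rw [integral_sub (BoundedContinuousFunction.integrable _ _) (integrable_const _),
        charFun_eq_integral_innerProbChar]
      simp
    rw [show (fun ξ : V => Complex.exp (∫ z,
        (BoundedContinuousFunction.innerProbChar ξ z - 1) ∂m)) = fun ξ =>
        Complex.exp (charFun m ξ - m.real Set.univ) from
        funext fun ξ => congrArg Complex.exp (congrFun this ξ)]
    fun_prop
  -- Fourier characters produce the weak limit; weak convergence then yields the formula for every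
  -- bounded continuous character of `K`.
  obtain ⟨R, hR, hRK, -, hRχ⟩ := exists_tendsto_integral_of_tendsto_charFun hK hQ hQK
    hcont.continuousAt fun ξ => by
      simpa only [charFun_eq_integral_innerProbChar] using hlim _ (isCharOn_innerProbChar K ξ)
  exact ⟨R, hR, hRK, fun χ hχ => tendsto_nhds_unique (hRχ χ) (hlim χ hχ)⟩

end Laws

end CBI

/-! ### Infinitely divisible laws, by truncating the Lévy measure near the origin. -/

namespace CBI

theorem norm_cexp_mul_I_sub_one_le_abs (u : ℝ) : ‖Complex.exp (u * Complex.I) - 1‖ ≤ |u| := by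
  rw [mul_comm]
  exact Real.norm_exp_I_mul_ofReal_sub_one_le

theorem norm_cexp_mul_I_sub_one_le_two (u : ℝ) : ‖Complex.exp (u * Complex.I) - 1‖ ≤ 2 := by
  refine (norm_sub_le _ _).trans ?_
  rw [Complex.norm_exp_ofReal_mul_I, norm_one]
  norm_num

theorem norm_cexp_mul_I_sub_one_sub_le (u : ℝ) :
    ‖Complex.exp (u * Complex.I) - 1 - u * Complex.I‖ ≤ 3 * u ^ 2 := by
  have hnorm : ‖(u : ℂ) * Complex.I‖ = |u| := by simp
  rcases le_or_gt |u| 1 with h | h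
  · have := Complex.norm_exp_sub_one_sub_id_le (x := u * Complex.I) (by rwa [hnorm])
    rw [hnorm, sq_abs] at this
    nlinarith [sq_nonneg u]
  · have h1 := norm_sub_le (Complex.exp (u * Complex.I) - 1) (u * Complex.I)
    rw [hnorm] at h1
    have h2 := norm_cexp_mul_I_sub_one_le_two u
    have h3 := sq_abs u
    nlinarith

section InfinitelyDivisible

variable {V : Type*} [NormedAddCommGroup V] [InnerProductSpace ℝ V]

theorem norm_innerProbChar_sub_one_le (ξ z : V) :
    ‖BoundedContinuousFunction.innerProbChar ξ z - 1‖ ≤ (2 + ‖ξ‖) * min 1 ‖z‖ := by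
  rw [BoundedContinuousFunction.innerProbChar_apply]
  rcases le_total 1 ‖z‖ with h | h
  · rw [min_eq_left h]
    linarith [norm_cexp_mul_I_sub_one_le_two (inner ℝ z ξ), norm_nonneg ξ]
  · rw [min_eq_right h]
    have h1 := norm_cexp_mul_I_sub_one_le_abs (inner ℝ z ξ)
    have h2 := abs_real_inner_le_norm z ξ
    nlinarith [norm_nonneg z]

variable [MeasurableSpace V] [BorelSpace V]

-- The truncation sets increase to the complement of the origin, and `F 0 = 0` makes a possible atom
-- there harmless.
omit [InnerProductSpace ℝ V] in
theorem tendsto_setIntegral_norm_gt {κ : Measure V} {F : V → ℂ} (hF : Integrable F κ)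
    (h0 : F 0 = 0) :
    Tendsto (fun n : ℕ => ∫ z in {z | 1 / ((n : ℝ) + 2) < ‖z‖}, F z ∂κ) atTop
      (𝓝 (∫ z, F z ∂κ)) := by
  have hU : ⋃ n : ℕ, {z : V | 1 / ((n : ℝ) + 2) < ‖z‖} = {0}ᶜ := by
    ext z
    simp only [Set.mem_iUnion, Set.mem_ofPred_eq, Set.mem_compl_iff, Set.mem_singleton_iff]
    refine ⟨?_, fun hz => ?_⟩
    · rintro ⟨n, hn⟩ rfl
      rw [norm_zero] at hn
      exact absurd hn (not_lt.2 (by positivity))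
    · obtain ⟨n, hn⟩ := exists_nat_one_div_lt (norm_pos_iff.2 hz)
      refine ⟨n, lt_of_le_of_lt ?_ hn⟩
      gcongr
      norm_num
  have h1 := tendsto_setIntegral_of_monotone (μ := κ) (f := F)
    (s := fun n : ℕ => {z : V | 1 / ((n : ℝ) + 2) < ‖z‖})
    (fun n => measurableSet_lt measurable_const measurable_norm) ?_ hF.integrableOn
  · rw [hU, setIntegral_eq_integral_of_forall_compl_eq_zero] at h1
    · exact h1
    · intro x hx
      rw [Set.mem_compl_iff, not_not, Set.mem_singleton_iff] at hx
      rw [hx, h0]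
  · intro a b hab z hz
    have hz' : 1 / ((a : ℝ) + 2) < ‖z‖ := hz
    refine lt_of_le_of_lt (b := 1 / ((a : ℝ) + 2)) ?_ hz'
    gcongr

omit [InnerProductSpace ℝ V] [BorelSpace V] in
theorem isFiniteMeasure_restrict_norm_gt {κ : Measure V}
    (hκ : Integrable (fun z => min 1 ‖z‖) κ) (n : ℕ) :
    IsFiniteMeasure (κ.restrict {z | 1 / ((n : ℝ) + 2) < ‖z‖}) := by
  have hpos : (0 : ℝ) < 1 / ((n : ℝ) + 2) := by positivity
  -- The shift by 2 keeps every radius below 1, so that `‖z‖` exceeding it forces `min 1 ‖z‖` to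
  -- exceed it.
  have h1 : 1 / ((n : ℝ) + 2) < 1 := by
    rw [div_lt_one (by positivity)]
    linarith [(Nat.cast_nonneg n : (0 : ℝ) ≤ n)]
  refine ⟨?_⟩
  rw [Measure.restrict_apply_univ]
  refine lt_of_le_of_lt (measure_mono fun z hz => ?_) (hκ.measure_gt_lt_top hpos)
  exact lt_min h1 hz

variable [FiniteDimensional ℝ V]

/-- Existence of infinitely divisible laws without Gaussian part and drift whose jumps have finite
variation. -/
theorem exists_infinitelyDivisible {K : AddSubmonoid V} (hK : IsClosed (K : Set V))
    {κ : Measure V} (hκ : Integrable (fun z => min 1 ‖z‖) κ) (hκK : κ (K : Set V)ᶜ = 0) :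
    ∃ Q : Measure V, IsProbabilityMeasure Q ∧ Q (K : Set V)ᶜ = 0 ∧
      ∀ χ : BoundedContinuousFunction V ℂ, IsCharOn K χ → ∀ C : ℝ,
        (∀ z ∈ K, ‖χ z - 1‖ ≤ C * min 1 ‖z‖) →
          ∫ z, χ z ∂Q = Complex.exp (∫ z, (χ z - 1) ∂κ) := by
  have hfin := isFiniteMeasure_restrict_norm_gt hκ
  have hmK : ∀ n : ℕ, κ.restrict {z | 1 / ((n : ℝ) + 2) < ‖z‖} (K : Set V)ᶜ = 0 :=
    fun n => nonpos_iff_eq_zero.1 ((Measure.restrict_apply_le _ _).trans hκK.le)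
  choose Q hQ hQK hQχ using fun n : ℕ =>
    exists_compoundPoisson hK (κ.restrict {z | 1 / ((n : ℝ) + 2) < ‖z‖}) (hmK n)
  have hlim : ∀ χ : BoundedContinuousFunction V ℂ, IsCharOn K χ → ∀ C : ℝ,
      (∀ z ∈ K, ‖χ z - 1‖ ≤ C * min 1 ‖z‖) →
        Tendsto (fun n => ∫ z, χ z ∂Q n) atTop (𝓝 (Complex.exp (∫ z, (χ z - 1) ∂κ))) := by
    intro χ hχ C hC
    simp_rw [fun n => hQχ n χ hχ]
    refine (Complex.continuous_exp.tendsto _).comp (tendsto_setIntegral_norm_gt ?_ ?_)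
    · refine (hκ.const_mul C).mono' (by fun_prop) ?_
      filter_upwards [mem_ae_iff.2 hκK] with z hz using hC z hz
    · rw [hχ.1, sub_self]
  have hcont : ContinuousAt (fun ξ : V =>
      Complex.exp (∫ z, (BoundedContinuousFunction.innerProbChar ξ z - 1) ∂κ)) 0 := by
    refine Complex.continuous_exp.continuousAt.comp ?_
    refine continuousAt_of_dominated (bound := fun z => (2 + 1) * min 1 ‖z‖) ?_ ?_
      (hκ.const_mul _) ?_
    · exact Eventually.of_forall fun ξ => by fun_prop
    · filter_upwards [Metric.ball_mem_nhds (0 : V) one_pos] with ξ hξ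
      rw [mem_ball_zero_iff] at hξ
      refine Eventually.of_forall fun z => (norm_innerProbChar_sub_one_le ξ z).trans ?_
      have : 0 ≤ min 1 ‖z‖ := le_min zero_le_one (norm_nonneg z)
      gcongr
    · refine Eventually.of_forall fun z => Continuous.continuousAt ?_
      simp_rw [BoundedContinuousFunction.innerProbChar_apply]
      fun_prop
  obtain ⟨R, hR, hRK, -, hRχ⟩ := exists_tendsto_integral_of_tendsto_charFun hK hQ hQK
    hcont fun ξ => by
      simpa only [charFun_eq_integral_innerProbChar] using
        hlim _ (isCharOn_innerProbChar K ξ) _ fun z _ => norm_innerProbChar_sub_one_le ξ z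
  exact ⟨R, hR, hRK, fun χ hχ C hC => tendsto_nhds_unique (hRχ χ) (hlim χ hχ C hC)⟩

/-- Existence of centred infinitely divisible laws without Gaussian part whose jumps are square
integrable. -/
theorem exists_compensated_infinitelyDivisible {κ : Measure V}
    (hκ : Integrable (fun z => ‖z‖ ^ 2) κ) :
    ∃ Q : Measure V, IsProbabilityMeasure Q ∧ ∀ ξ, charFun Q ξ = Complex.exp
      (∫ z, (Complex.exp (inner ℝ z ξ * Complex.I) - 1 - inner ℝ z ξ * Complex.I) ∂κ) := by
  have hbd : ∀ ξ z : V,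
      ‖Complex.exp (inner ℝ z ξ * Complex.I) - 1 - inner ℝ z ξ * Complex.I‖ ≤
        3 * ‖ξ‖ ^ 2 * ‖z‖ ^ 2 := by
    intro ξ z
    refine (norm_cexp_mul_I_sub_one_sub_le _).trans ?_
    have h1 : (inner ℝ z ξ) ^ 2 ≤ (‖z‖ * ‖ξ‖) ^ 2 := by
      rw [← sq_abs]
      exact pow_le_pow_left₀ (abs_nonneg _) (abs_real_inner_le_norm z ξ) 2
    nlinarith
  have hint : ∀ ξ : V, Integrable (fun z : V =>
      Complex.exp (inner ℝ z ξ * Complex.I) - 1 - inner ℝ z ξ * Complex.I) κ := fun ξ =>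
    (hκ.const_mul (3 * ‖ξ‖ ^ 2)).mono' (by fun_prop) (Eventually.of_forall (hbd ξ))
  have hstep : ∀ n : ℕ, ∃ Q : Measure V, IsProbabilityMeasure Q ∧ ∀ ξ, charFun Q ξ =
      Complex.exp (∫ z in {z | 1 / ((n : ℝ) + 2) < ‖z‖},
        (Complex.exp (inner ℝ z ξ * Complex.I) - 1 - inner ℝ z ξ * Complex.I) ∂κ) := by
    intro n
    set m := κ.restrict {z | 1 / ((n : ℝ) + 2) < ‖z‖} with hm
    have hS : MeasurableSet {z : V | 1 / ((n : ℝ) + 2) < ‖z‖} :=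
      measurableSet_lt measurable_const measurable_norm
    have hfin : IsFiniteMeasure m := by
      refine ⟨?_⟩
      rw [hm, Measure.restrict_apply_univ]
      have hpos : (0 : ℝ) < (1 / ((n : ℝ) + 2)) ^ 2 := by positivity
      refine lt_of_le_of_lt (measure_mono fun z hz => ?_) (hκ.measure_gt_lt_top hpos)
      have hz' : 1 / ((n : ℝ) + 2) < ‖z‖ := hz
      exact pow_lt_pow_left₀ hz' (by positivity) two_ne_zero
    have hid : Integrable (fun z : V => z) m := by
      refine Integrable.mono' ((hκ.const_mul ((n : ℝ) + 2)).restrict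
        (s := {z | 1 / ((n : ℝ) + 2) < ‖z‖})) (by fun_prop) ?_
      filter_upwards [ae_restrict_mem hS] with z hz
      have hz' : 1 / ((n : ℝ) + 2) < ‖z‖ := hz
      rw [div_lt_iff₀ (by positivity)] at hz'
      nlinarith [norm_nonneg z]
    obtain ⟨Q, hQ, -, hQχ⟩ := exists_compoundPoisson (K := (⊤ : AddSubmonoid V))
      (by simp) m (by simp)
    -- Translating the compound Poisson law by minus its mean produces the compensator; the mean
    -- exists because jumps are square integrable and bounded away from zero.
    refine ⟨Q.map (· + -∫ z, z ∂m), Measure.isProbabilityMeasure_map (by fun_prop), fun ξ => ?_⟩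
    have h1 := hQχ _ (isCharOn_innerProbChar ⊤ ξ)
    rw [← charFun_eq_integral_innerProbChar] at h1
    have hinner : Integrable (fun z : V => ((inner ℝ z ξ : ℝ) : ℂ) * Complex.I) m :=
      (hid.inner_const ξ).ofReal.mul_const _
    have hchi : Integrable (fun z : V => Complex.exp (inner ℝ z ξ * Complex.I) - 1) m :=
      (BoundedContinuousFunction.integrable m
        (BoundedContinuousFunction.innerProbChar ξ)).sub (integrable_const _)
    rw [charFun_map_add_const, h1, ← Complex.exp_add, integral_sub hchi hinner,
      integral_mul_const, inner_neg_left, integral_complex_ofReal]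
    simp_rw [fun z : V => real_inner_comm ξ z]
    rw [integral_inner hid]
    simp only [BoundedContinuousFunction.innerProbChar_apply, Complex.ofReal_neg, neg_mul,
      sub_eq_add_neg, real_inner_comm]
  choose Q hQ hQχ using hstep
  have hcont : ContinuousAt (fun ξ : V => Complex.exp
      (∫ z, (Complex.exp (inner ℝ z ξ * Complex.I) - 1 - inner ℝ z ξ * Complex.I) ∂κ)) 0 := by
    refine Complex.continuous_exp.continuousAt.comp ?_
    refine continuousAt_of_dominated (bound := fun z => 3 * 1 ^ 2 * ‖z‖ ^ 2) ?_ ?_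
      (hκ.const_mul _) ?_
    · exact Eventually.of_forall fun ξ => by fun_prop
    · filter_upwards [Metric.ball_mem_nhds (0 : V) one_pos] with ξ hξ
      rw [mem_ball_zero_iff] at hξ
      refine Eventually.of_forall fun z => (hbd ξ z).trans ?_
      gcongr
    · exact Eventually.of_forall fun z => Continuous.continuousAt (by fun_prop)
  obtain ⟨R, hR, -, hRχ, -⟩ := exists_tendsto_integral_of_tendsto_charFun isClosed_univ hQ
    (fun n => by simp) hcont fun ξ => by
      simp_rw [fun n => hQχ n ξ]
      exact (Complex.continuous_exp.tendsto _).comp (tendsto_setIntegral_norm_gt (hint ξ) (by simp))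
  exact ⟨R, hR, hRχ⟩

end InfinitelyDivisible

end CBI

namespace CBI

/-! ### Fourier inversion for probability measures. -/

section FourierInversion

open FourierTransform Real

variable {V : Type*} [NormedAddCommGroup V] [InnerProductSpace ℝ V] [FiniteDimensional ℝ V]
  [MeasurableSpace V] [BorelSpace V]

/-- The characteristic function in the normalization of `𝓕`. -/
noncomputable def fourierMeasure (Q : Measure V) (w : V) : ℂ := charFun Q (-((2 * π) • w))

omit [FiniteDimensional ℝ V] [BorelSpace V] in
theorem fourierMeasure_apply (Q : Measure V) (w : V) :
    fourierMeasure Q w = ∫ y, Complex.exp (((-2 * π * inner ℝ y w : ℝ) : ℂ) * Complex.I) ∂Q := by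
  rw [fourierMeasure, charFun_apply]
  simp only [inner_neg_right, inner_smul_right, ← neg_mul]

theorem continuous_fourierInv {f : V → ℂ} (hf : Integrable f) : Continuous (𝓕⁻ f) := by
  refine VectorFourier.fourierIntegral_continuous Real.continuous_fourierChar ?_ hf
  exact (continuous_inner (𝕜 := ℝ) (E := V)).neg

theorem norm_fourierInv_le (f : V → ℂ) (z : V) : ‖𝓕⁻ f z‖ ≤ ∫ w, ‖f w‖ := by
  rw [Real.fourierInv_eq']
  refine (norm_integral_le_integral_norm _).trans_eq (integral_congr_ae ?_)
  exact Eventually.of_forall fun w => by simp only [norm_smul, Complex.norm_exp_ofReal_mul_I, one_mul]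

theorem norm_fourierInv_add_sub_le {f : V → ℂ} (hf : Integrable f)
    (hf1 : Integrable fun w => ‖w‖ * ‖f w‖) (z h : V) :
    ‖𝓕⁻ f (z + h) - 𝓕⁻ f z‖ ≤ 2 * π * ‖h‖ * ∫ w, ‖w‖ * ‖f w‖ := by
  have hint : ∀ z : V,
      Integrable fun w => Complex.exp (((2 * π * inner ℝ w z : ℝ) : ℂ) * Complex.I) • f w := by
    intro z
    have hm := hf.1
    refine hf.norm.mono' (by fun_prop) ?_
    exact Eventually.of_forall fun w => by
      simp only [norm_smul, Complex.norm_exp_ofReal_mul_I, one_mul, le_refl]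
  rw [Real.fourierInv_eq', Real.fourierInv_eq', ← integral_sub (hint _) (hint _),
    ← integral_const_mul]
  refine norm_integral_le_of_norm_le (hf1.const_mul _) (Eventually.of_forall fun w => ?_)
  have h1 : Complex.exp (((2 * π * inner ℝ w (z + h) : ℝ) : ℂ) * Complex.I) • f w -
      Complex.exp (((2 * π * inner ℝ w z : ℝ) : ℂ) * Complex.I) • f w =
      Complex.exp (((2 * π * inner ℝ w z : ℝ) : ℂ) * Complex.I) *
        (Complex.exp (((2 * π * inner ℝ w h : ℝ) : ℂ) * Complex.I) - 1) * f w := by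
    rw [inner_add_right, mul_add, Complex.ofReal_add, add_mul, Complex.exp_add, smul_eq_mul,
      smul_eq_mul]
    ring
  rw [h1, norm_mul, norm_mul, Complex.norm_exp_ofReal_mul_I, one_mul, ← mul_assoc]
  refine mul_le_mul_of_nonneg_right ?_ (norm_nonneg _)
  refine (norm_cexp_mul_I_sub_one_le_abs _).trans ?_
  rw [abs_mul, abs_of_pos (by positivity : 0 < 2 * π)]
  nlinarith [abs_real_inner_le_norm w h, pi_pos]

/-- The Gaussian regularization of the inverse Fourier transform of a measure. -/
theorem fourierInv_gaussian_mul_fourierMeasure (Q : Measure V) [IsProbabilityMeasure Q] {b : ℝ}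
    (hb : 0 < b) (z : V) :
    𝓕⁻ (fun w => Complex.exp (-b * ‖w‖ ^ 2) * fourierMeasure Q w) z =
      ((∫ y, (π / b) ^ (Module.finrank ℝ V / 2 : ℝ) * rexp (-(π ^ 2 / b) * ‖y - z‖ ^ 2) ∂Q : ℝ) :
        ℂ) := by
  have hb' : 0 < (b : ℂ).re := by simpa using hb
  have hG : Integrable fun w : V => Complex.exp (-b * ‖w‖ ^ 2) := by
    simpa using GaussianFourier.integrable_cexp_neg_mul_sq_norm_add hb' 0 (0 : V)
  rw [Real.fourierInv_eq']
  simp_rw [fourierMeasure_apply, smul_eq_mul, ← integral_const_mul]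
  rw [integral_integral_swap]
  · rw [← integral_complex_ofReal]
    refine integral_congr_ae (Eventually.of_forall fun y => ?_)
    have h1 := fourier_gaussian_innerProductSpace hb' (y - z)
    rw [Real.fourier_eq'] at h1
    have h2 : ∀ w : V, Complex.exp (((2 * π * inner ℝ w z : ℝ) : ℂ) * Complex.I) *
        (Complex.exp (-b * ‖w‖ ^ 2) *
          Complex.exp (((-2 * π * inner ℝ y w : ℝ) : ℂ) * Complex.I)) =
        Complex.exp (((-2 * π * inner ℝ w (y - z) : ℝ) : ℂ) * Complex.I) •
          Complex.exp (-b * ‖w‖ ^ 2) := by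
      intro w
      rw [smul_eq_mul, ← Complex.exp_add, ← Complex.exp_add, ← Complex.exp_add, inner_sub_right,
        real_inner_comm w y]
      congr 1
      push_cast
      ring
    simp_rw [h2, h1]
    push_cast
    rw [Complex.ofReal_cpow (by positivity)]
    push_cast
    congr 2
    ring
  · have hprod : Integrable (fun p : V × V => Complex.exp (-b * ‖p.1‖ ^ 2) * (1 : ℂ))
        (volume.prod Q) := hG.mul_prod (integrable_const _)
    refine hprod.norm.mono' ?_ (Eventually.of_forall fun p => ?_)
    · refine Continuous.aestronglyMeasurable ?_
      simp only [Function.uncurry_def]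
      fun_prop
    · simp only [Function.uncurry_def, norm_mul, Complex.norm_exp_ofReal_mul_I, norm_one, one_mul,
        le_refl]

/-- The regularization is the convolution of `Q` with a normalized Gaussian, so Tonelli gives mass
one. This supplies the Fatou bound for the limiting density. -/
theorem lintegral_gaussian_regularization (Q : Measure V) [IsProbabilityMeasure Q] {b : ℝ}
    (hb : 0 < b) :
    ∫⁻ z, ENNReal.ofReal
      (∫ y, (π / b) ^ (Module.finrank ℝ V / 2 : ℝ) * rexp (-(π ^ 2 / b) * ‖y - z‖ ^ 2) ∂Q) = 1 := by
  set a : ℝ := (π / b) ^ (Module.finrank ℝ V / 2 : ℝ) with ha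
  have ha0 : 0 < a := by positivity
  have h1 : ∀ z : V, ENNReal.ofReal (∫ y, a * rexp (-(π ^ 2 / b) * ‖y - z‖ ^ 2) ∂Q) =
      ∫⁻ y, ENNReal.ofReal (a * rexp (-(π ^ 2 / b) * ‖y - z‖ ^ 2)) ∂Q := by
    intro z
    refine ofReal_integral_eq_lintegral_ofReal ?_ (Eventually.of_forall fun y => by positivity)
    refine (integrable_const a).mono' (by fun_prop) (Eventually.of_forall fun y => ?_)
    rw [norm_of_nonneg (by positivity)]
    refine mul_le_of_le_one_right ha0.le (exp_le_one_iff.2 ?_)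
    have : 0 ≤ π ^ 2 / b * ‖y - z‖ ^ 2 := by positivity
    linarith
  simp_rw [h1]
  rw [lintegral_lintegral_swap (by fun_prop)]
  have hc : 0 < π ^ 2 / b := by positivity
  have hGi : Integrable fun v : V => rexp (-(π ^ 2 / b) * ‖v‖ ^ 2) := by
    have := (GaussianFourier.integrable_cexp_neg_mul_sq_norm_add
      (b := ((π ^ 2 / b : ℝ) : ℂ)) (by rw [Complex.ofReal_re]; exact hc) 0 (0 : V)).re
    refine this.congr (Eventually.of_forall fun v => ?_)
    have h1 : Complex.exp (-((π ^ 2 / b : ℝ) : ℂ) * ‖v‖ ^ 2 + 0 * (inner ℝ (0 : V) v : ℝ)) =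
        ((rexp (-(π ^ 2 / b) * ‖v‖ ^ 2) : ℝ) : ℂ) := by
      push_cast
      simp
    change (Complex.exp (-((π ^ 2 / b : ℝ) : ℂ) * ‖v‖ ^ 2 + 0 * (inner ℝ (0 : V) v : ℝ))).re = _
    rw [h1, Complex.ofReal_re]
  have h2 : ∀ y : V, ∫⁻ z, ENNReal.ofReal (a * rexp (-(π ^ 2 / b) * ‖y - z‖ ^ 2)) = 1 := by
    intro y
    rw [lintegral_sub_left_eq_self (fun z : V => ENNReal.ofReal (a * rexp (-(π ^ 2 / b) * ‖z‖ ^ 2))) y,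
      ← ofReal_integral_eq_lintegral_ofReal (hGi.const_mul a)
        (Eventually.of_forall fun y => by positivity), integral_const_mul,
      GaussianFourier.integral_rexp_neg_mul_sq_norm hc, ha,
      ← mul_rpow (by positivity) (by positivity)]
    have : π / b * (π / (π ^ 2 / b)) = 1 := by field_simp
    rw [this, one_rpow, ENNReal.ofReal_one]
  simp only [h2, lintegral_const, measure_univ, mul_one]

theorem tendsto_fourierInv_gaussian_mul {f : V → ℂ} (hf : Integrable f) (z : V) :
    Tendsto (fun n : ℕ => 𝓕⁻ (fun w => Complex.exp (-((1 / ((n : ℝ) + 1) : ℝ) : ℂ) * ‖w‖ ^ 2) * f w) z)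
      atTop (𝓝 (𝓕⁻ f z)) := by
  simp_rw [Real.fourierInv_eq']
  refine tendsto_integral_of_dominated_convergence (fun w => ‖f w‖) (fun n => ?_) hf.norm
    (fun n => Eventually.of_forall fun w => ?_) (Eventually.of_forall fun w => ?_)
  · have hm := hf.1
    fun_prop
  · rw [norm_smul, Complex.norm_exp_ofReal_mul_I, one_mul, norm_mul]
    refine mul_le_of_le_one_left (norm_nonneg _) ?_
    rw [Complex.norm_exp, exp_le_one_iff]
    have h1 : -((1 / ((n : ℝ) + 1) : ℝ) : ℂ) * (‖w‖ : ℂ) ^ 2 =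
        ((-(1 / ((n : ℝ) + 1) * ‖w‖ ^ 2) : ℝ) : ℂ) := by push_cast; ring
    rw [h1, Complex.ofReal_re, neg_nonpos]
    positivity
  · refine Tendsto.const_smul ?_ _
    have h1 : Tendsto (fun n : ℕ => Complex.exp (-((1 / ((n : ℝ) + 1) : ℝ) : ℂ) * ‖w‖ ^ 2)) atTop
        (𝓝 (Complex.exp (-((0 : ℝ) : ℂ) * ‖w‖ ^ 2))) := by
      refine (Complex.continuous_exp.tendsto _).comp (Tendsto.mul_const _ (Tendsto.neg ?_))
      exact (Complex.continuous_ofReal.tendsto _).comp tendsto_one_div_add_atTop_nhds_zero_nat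
    simpa using h1.mul_const (f w)

/-- A probability measure with integrable characteristic function has a continuous density, given
by the Fourier inversion formula. -/
theorem exists_density_of_integrable_fourierMeasure (Q : Measure V) [IsProbabilityMeasure Q]
    (hQ : Integrable (fourierMeasure Q)) :
    ∃ f : V → ℝ, Continuous f ∧ (∀ z, 0 ≤ f z) ∧
      Q = volume.withDensity (fun z => ENNReal.ofReal (f z)) ∧
      ∀ z, (f z : ℂ) = 𝓕⁻ (fourierMeasure Q) z := by
  set ψ := fourierMeasure Q with hψ
  set γ : ℕ → V → ℝ := fun n z => ∫ y, (π / (1 / ((n : ℝ) + 1))) ^ (Module.finrank ℝ V / 2 : ℝ) *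
    rexp (-(π ^ 2 / (1 / ((n : ℝ) + 1))) * ‖y - z‖ ^ 2) ∂Q with hγ
  have hlimc : ∀ z, Tendsto (fun n => ((γ n z : ℝ) : ℂ)) atTop (𝓝 (𝓕⁻ ψ z)) := fun z =>
    (tendsto_fourierInv_gaussian_mul hQ z).congr fun n =>
      fourierInv_gaussian_mul_fourierMeasure Q (by positivity) z
  have hlim : ∀ z, Tendsto (fun n => γ n z) atTop (𝓝 (𝓕⁻ ψ z).re) := fun z =>
    (Complex.continuous_re.tendsto _).comp (hlimc z)
  have hγ0 : ∀ n z, 0 ≤ γ n z := fun n z => integral_nonneg fun y => by positivity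
  have hf0 : ∀ z, 0 ≤ (𝓕⁻ ψ z).re := fun z => ge_of_tendsto' (hlim z) fun n => hγ0 n z
  have hfc : ∀ z, (((𝓕⁻ ψ z).re : ℝ) : ℂ) = 𝓕⁻ ψ z := fun z =>
    tendsto_nhds_unique ((Complex.continuous_ofReal.tendsto _).comp (hlim z)) (hlimc z)
  have hcont : Continuous (𝓕⁻ ψ) := continuous_fourierInv hQ
  have hrecont : Continuous fun z => (𝓕⁻ ψ z).re := Complex.continuous_re.comp hcont
  have hmeas : ∀ n, Measurable fun z => ENNReal.ofReal (γ n z) := by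
    intro n
    refine ENNReal.measurable_ofReal.comp ?_
    refine (StronglyMeasurable.integral_prod_right'
      (f := fun p : V × V => (π / (1 / ((n : ℝ) + 1))) ^ (Module.finrank ℝ V / 2 : ℝ) *
    rexp (-(π ^ 2 / (1 / ((n : ℝ) + 1))) * ‖p.2 - p.1‖ ^ 2)) ?_).measurable
    exact Continuous.stronglyMeasurable (by fun_prop)
  -- Fatou: the candidate density is the pointwise limit of densities of mass one. Its integrability
  -- is what permits inverting the transform back to `ψ`; the full mass follows from equality of
  -- characteristic functions.
  have hle : ∫⁻ z, ENNReal.ofReal (𝓕⁻ ψ z).re ≤ 1 := by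
    have h1 : ∀ z, ENNReal.ofReal (𝓕⁻ ψ z).re =
        liminf (fun n => ENNReal.ofReal (γ n z)) atTop := fun z =>
      ((ENNReal.tendsto_ofReal (hlim z)).liminf_eq).symm
    simp_rw [h1]
    refine (lintegral_liminf_le hmeas).trans ?_
    simp_rw [hγ, fun n : ℕ => lintegral_gaussian_regularization Q
      (by positivity : 0 < 1 / ((n : ℝ) + 1))]
    simp
  have hfint : Integrable fun z => (𝓕⁻ ψ z).re :=
    ⟨hrecont.aestronglyMeasurable, by
      rw [hasFiniteIntegral_iff_ofReal (Eventually.of_forall hf0)]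
      exact hle.trans_lt ENNReal.one_lt_top⟩
  have hfintc : Integrable (𝓕⁻ ψ) := hfint.ofReal.congr (Eventually.of_forall hfc)
  have hψc : Continuous ψ := by
    rw [hψ]
    unfold fourierMeasure
    fun_prop
  have hfin : IsFiniteMeasure (volume.withDensity fun z => ENNReal.ofReal (𝓕⁻ ψ z).re) :=
    isFiniteMeasure_withDensity (hle.trans_lt ENNReal.one_lt_top).ne
  refine ⟨fun z => (𝓕⁻ ψ z).re, hrecont, hf0, ?_, hfc⟩
  refine Measure.ext_of_charFun (funext fun ξ => ?_)
  have hinv : 𝓕 (𝓕⁻ ψ) = ψ := hψc.fourier_fourierInv_eq hQ <| by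
    have h1 : 𝓕 ψ = fun z => 𝓕⁻ ψ (-z) := by
      ext z
      rw [Real.fourierInv_eq_fourier_neg, neg_neg]
    rw [h1]
    exact hfintc.comp_neg
  have h2 := congrFun hinv (-(2 * π)⁻¹ • ξ)
  have h3 : -((2 * π) • (-(2 * π)⁻¹ • ξ)) = ξ := by
    rw [smul_smul, mul_neg, mul_inv_cancel₀ (by positivity), neg_smul, one_smul, neg_neg]
  rw [hψ, fourierMeasure, ← hψ, h3, Real.fourier_eq'] at h2
  rw [← h2, charFun_apply, integral_withDensity_eq_integral_toReal_smul (by fun_prop)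
    (Eventually.of_forall fun _ => ENNReal.ofReal_lt_top)]
  refine integral_congr_ae (Eventually.of_forall fun z => ?_)
  simp only [ENNReal.toReal_ofReal (hf0 z), inner_smul_right, Complex.real_smul, smul_eq_mul]
  rw [hfc, mul_comm]
  congr 4
  field_simp

end FourierInversion

end CBI

namespace CBI

/-! ### The `L¹` modulus of continuity under convolution. -/

section Convolution

variable {V : Type*} [NormedAddCommGroup V] [InnerProductSpace ℝ V] [FiniteDimensional ℝ V]
  [MeasurableSpace V] [BorelSpace V]

theorem integrable_of_isFiniteMeasure_withDensity {p : V → ℝ} (hp : Measurable p)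
    (hp0 : ∀ z, 0 ≤ p z)
    (hfin : IsFiniteMeasure (volume.withDensity fun z => ENNReal.ofReal (p z))) :
    Integrable p := by
  refine ⟨hp.aestronglyMeasurable, ?_⟩
  rw [hasFiniteIntegral_iff_ofReal (Eventually.of_forall hp0)]
  have := measure_lt_top (volume.withDensity fun z => ENNReal.ofReal (p z)) Set.univ
  rwa [withDensity_apply _ MeasurableSet.univ, setLIntegral_univ] at this

theorem integral_abs_translate_sub_le {p : V → ℝ} (hp : Integrable p) (h : V) :
    ∫ z, |p (z + h) - p z| ≤ 2 * ∫ z, |p z| := by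
  have h1 : Integrable fun z => p (z + h) := hp.comp_add_right h
  calc ∫ z, |p (z + h) - p z| ≤ ∫ z, (|p (z + h)| + |p z|) :=
        integral_mono (h1.sub hp).abs (h1.abs.add hp.abs) fun z => abs_sub _ _
    _ = 2 * ∫ z, |p z| := by
        rw [integral_add h1.abs hp.abs, integral_add_right_eq_self (fun z => |p z|) h]
        ring

/-- Convolution with a probability measure decreases the `L¹` modulus of continuity of a
density. -/
theorem exists_density_conv {p : V → ℝ} (hp : Measurable p) (hp0 : ∀ z, 0 ≤ p z)
    [hP : IsProbabilityMeasure (volume.withDensity fun z => ENNReal.ofReal (p z))]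
    (S : Measure V) [IsProbabilityMeasure S] :
    ∃ g : V → ℝ, Measurable g ∧ (∀ z, 0 ≤ g z) ∧
      (volume.withDensity fun z => ENNReal.ofReal (p z)) ∗ S =
        volume.withDensity (fun z => ENNReal.ofReal (g z)) ∧
      ∀ h, ∫ z, |g (z + h) - g z| ≤ ∫ z, |p (z + h) - p z| := by
  set P := volume.withDensity fun z => ENNReal.ofReal (p z) with hPdef
  have hpint : Integrable p := integrable_of_isFiniteMeasure_withDensity hp hp0 inferInstance
  -- The convolved density may be infinite on a null set, so it is handled as an extended-valued
  -- function and made real only at the end.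
  set G : V → ℝ≥0∞ := fun z => ∫⁻ y, ENNReal.ofReal (p (z - y)) ∂S with hG
  have hGm : Measurable G := Measurable.lintegral_prod_right (by fun_prop)
  have hconv : P ∗ S = volume.withDensity G := by
    refine Measure.ext_of_lintegral _ fun f hf => ?_
    rw [Measure.lintegral_conv hf, hPdef, lintegral_withDensity_eq_lintegral_mul _ (by fun_prop)
      (Measurable.lintegral_prod_right (by fun_prop)), lintegral_withDensity_eq_lintegral_mul _ hGm hf]
    simp only [Pi.mul_apply, hG]
    have h1 : ∀ x, ENNReal.ofReal (p x) * ∫⁻ y, f (x + y) ∂S =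
        ∫⁻ y, ENNReal.ofReal (p x) * f (x + y) ∂S := fun x =>
      (lintegral_const_mul _ (by fun_prop)).symm
    have h2 : ∀ x, (∫⁻ y, ENNReal.ofReal (p (x - y)) ∂S) * f x =
        ∫⁻ y, ENNReal.ofReal (p (x - y)) * f x ∂S := fun x =>
      (lintegral_mul_const _ (by fun_prop)).symm
    simp_rw [h1, h2]
    rw [lintegral_lintegral_swap (μ := volume) (ν := S)
        (f := fun x y => ENNReal.ofReal (p x) * f (x + y)) (by fun_prop),
      lintegral_lintegral_swap (μ := volume) (ν := S)
        (f := fun x y => ENNReal.ofReal (p (x - y)) * f x) (by fun_prop)]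
    refine lintegral_congr fun y => ?_
    rw [← lintegral_add_right_eq_self (fun x => ENNReal.ofReal (p (x - y)) * f x) y]
    simp
  have hGint : ∫⁻ z, G z = 1 := by
    have h1 : (P ∗ S) Set.univ = 1 := measure_univ
    rwa [hconv, withDensity_apply _ MeasurableSet.univ, setLIntegral_univ] at h1
  have hGfin : ∀ᵐ z, G z < ∞ := ae_lt_top hGm (by rw [hGint]; exact ENNReal.one_ne_top)
  have hpS : ∀ z, Measurable fun y => p (z - y) := fun z => by fun_prop
  have hGeq : ∀ z, (G z).toReal = ∫ y, p (z - y) ∂S := fun z =>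
    (integral_eq_lintegral_of_nonneg_ae (Eventually.of_forall fun y => hp0 _)
      (hpS z).aestronglyMeasurable).symm
  have hSint : ∀ z, G z < ∞ → Integrable (fun y => p (z - y)) S := fun z hz =>
    ⟨(hpS z).aestronglyMeasurable, by
      rw [hasFiniteIntegral_iff_ofReal (Eventually.of_forall fun y => hp0 _)]
      exact hz⟩
  refine ⟨fun z => (G z).toReal, hGm.ennreal_toReal, fun z => ENNReal.toReal_nonneg, ?_, fun h => ?_⟩
  · rw [hconv]
    refine withDensity_congr_ae ?_
    filter_upwards [hGfin] with z hz
    rw [ENNReal.ofReal_toReal hz.ne]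
  · have hph : Integrable fun z => p (z + h) - p z := (hpint.comp_add_right h).sub hpint
    have hGfin' : ∀ᵐ z, G (z + h) < ∞ :=
      (measurePreserving_add_right volume h).quasiMeasurePreserving.ae hGfin
    rw [integral_eq_lintegral_of_nonneg_ae (Eventually.of_forall fun _ => abs_nonneg _)
      (by fun_prop), integral_eq_lintegral_of_nonneg_ae
      (Eventually.of_forall fun _ => abs_nonneg _) (by fun_prop)]
    refine ENNReal.toReal_mono ?_ ?_
    · have := hph.abs.2
      rw [hasFiniteIntegral_iff_ofReal (Eventually.of_forall fun y => abs_nonneg _)] at this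
      exact this.ne
    · calc ∫⁻ z, ENNReal.ofReal |(G (z + h)).toReal - (G z).toReal|
          ≤ ∫⁻ z, ∫⁻ y, ENNReal.ofReal |p (z + h - y) - p (z - y)| ∂S := by
            refine lintegral_mono_ae ?_
            filter_upwards [hGfin, hGfin'] with z hz hz'
            have h1 : Integrable (fun y => |p (z + h - y) - p (z - y)|) S :=
              ((hSint _ hz').sub (hSint _ hz)).abs
            rw [hGeq, hGeq, ← integral_sub (hSint _ hz') (hSint _ hz),
              ← ofReal_integral_eq_lintegral_ofReal h1
                (Eventually.of_forall fun y => abs_nonneg _)]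
            exact ENNReal.ofReal_le_ofReal (abs_integral_le_integral_abs)
        _ = ∫⁻ y, (∫⁻ z, ENNReal.ofReal |p (z + h - y) - p (z - y)|) ∂S := by
            exact lintegral_lintegral_swap (by fun_prop)
        _ = ∫⁻ z, ENNReal.ofReal |p (z + h) - p z| := by
            have h1 : ∀ y, ∫⁻ z, ENNReal.ofReal |p (z + h - y) - p (z - y)| =
                ∫⁻ z, ENNReal.ofReal |p (z + h) - p z| := by
              intro y
              rw [← lintegral_sub_right_eq_self
                (fun z => ENNReal.ofReal |p (z + h) - p z|) y]
              refine lintegral_congr fun z => ?_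
              rw [sub_add_eq_add_sub]
            simp only [h1, lintegral_const, measure_univ, mul_one]

end Convolution

/-! ### From the symbol to truncated first moments of the Lévy measure. -/

section LevyMeasureBound

/-- With `A = max 1 (1/|y|)`, integrate over `[A, 5A]` only. The sine boundary terms cost at most
`2/|y| ≤ 2A` out of the length `4A`, and `θ ^ (-2) ≥ 1/(25 A²)` there, leaving `2/(25 A) = (2/25)
min 1 |y|`. -/
theorem min_one_le_lintegral_one_sub_cos (y : ℝ) :
    ENNReal.ofReal (min 1 |y|) ≤ ENNReal.ofReal (25 / 2) *
      ∫⁻ θ in Set.Ioi (1 : ℝ), ENNReal.ofReal ((1 - Real.cos (θ * y)) * θ ^ (-2 : ℝ)) := by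
  rcases eq_or_ne y 0 with rfl | hy
  · simp
  set a := |y| with ha
  have ha0 : 0 < a := abs_pos.2 hy
  set A := max 1 (1 / a) with hA
  have hA1 : 1 ≤ A := le_max_left _ _
  have hA0 : 0 < A := by linarith
  have hAa : 1 / a ≤ A := le_max_right _ _
  have hmin : min 1 a = 1 / A := by
    rcases le_total 1 a with h | h
    · rw [min_eq_left h, hA, max_eq_left ((div_le_one ha0).2 h), div_one]
    · rw [min_eq_right h, hA, max_eq_right ((one_le_div ha0).2 h), one_div_one_div]
  have hcos : ∀ θ : ℝ, Real.cos (θ * y) = Real.cos (a * θ) := by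
    intro θ
    rcases abs_choice y with h | h
    · rw [ha, h, mul_comm]
    · rw [ha, h, ← Real.cos_neg]
      congr 1
      ring
  have hint : ∫ θ in A..(5 * A), (1 - Real.cos (a * θ)) * (1 / (25 * A ^ 2)) =
      (4 * A - (Real.sin (a * (5 * A)) - Real.sin (a * A)) / a) * (1 / (25 * A ^ 2)) := by
    rw [intervalIntegral.integral_mul_const, intervalIntegral.integral_sub (by simp)
      (Continuous.intervalIntegrable (by fun_prop) _ _), intervalIntegral.integral_comp_mul_left _ ha0.ne',
      integral_cos, intervalIntegral.integral_const, smul_eq_mul, smul_eq_mul]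
    ring
  have hlow : 2 / (25 * A) ≤ ∫ θ in A..(5 * A), (1 - Real.cos (a * θ)) * (1 / (25 * A ^ 2)) := by
    rw [hint]
    have h1 : (Real.sin (a * (5 * A)) - Real.sin (a * A)) / a ≤ 2 * A := by
      rw [div_le_iff₀ ha0]
      rw [div_le_iff₀ ha0] at hAa
      nlinarith [Real.sin_le_one (a * (5 * A)), Real.neg_one_le_sin (a * A)]
    calc 2 / (25 * A) = (2 * A) * (1 / (25 * A ^ 2)) := by field_simp
      _ ≤ _ := mul_le_mul_of_nonneg_right (by linarith) (by positivity)
  have hpos : ∀ θ : ℝ, 0 ≤ 1 - Real.cos (a * θ) := fun θ => sub_nonneg.2 (Real.cos_le_one _)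
  calc ENNReal.ofReal (min 1 a) = ENNReal.ofReal (25 / 2) * ENNReal.ofReal (2 / (25 * A)) := by
        rw [hmin, ← ENNReal.ofReal_mul (by norm_num)]
        congr 1
        field_simp
    _ ≤ ENNReal.ofReal (25 / 2) *
        ∫⁻ θ in Set.Ioi (1 : ℝ), ENNReal.ofReal ((1 - Real.cos (θ * y)) * θ ^ (-2 : ℝ)) := by
        gcongr
        refine (ENNReal.ofReal_le_ofReal hlow).trans ?_
        rw [intervalIntegral.integral_of_le (by linarith), ofReal_integral_eq_lintegral_ofReal
          (Continuous.integrableOn_Ioc (by fun_prop))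
          (Eventually.of_forall fun θ => mul_nonneg (hpos θ) (by positivity))]
        refine le_trans ?_ (lintegral_mono_set (Set.Ioc_subset_Ioi_self.trans
          (Set.Ioi_subset_Ioi hA1) : Set.Ioc A (5 * A) ⊆ Set.Ioi 1))
        refine setLIntegral_mono (by fun_prop) fun θ hθ => ENNReal.ofReal_le_ofReal ?_
        rw [hcos]
        refine mul_le_mul_of_nonneg_left ?_ (hpos θ)
        have hθ0 : 0 < θ := hA0.trans hθ.1
        rw [Real.rpow_neg hθ0.le, Real.rpow_two, one_div]
        gcongr
        nlinarith [hθ.2]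

variable {V : Type*} [NormedAddCommGroup V] [InnerProductSpace ℝ V]
  [MeasurableSpace V] [BorelSpace V] [SecondCountableTopology V]

/-- An upper bound for the symbol controls the truncated first moments of the Lévy measure. -/
theorem lintegral_min_one_inner_le (ν : Measure V) [SFinite ν] {α C R : ℝ} (hα₁ : α < 1)
    (hC : 0 ≤ C)
    (hν : ∀ ξ : V, R ≤ ‖ξ‖ →
      ∫⁻ z, ENNReal.ofReal (1 - Real.cos (inner ℝ ξ z)) ∂ν ≤ ENNReal.ofReal (C * ‖ξ‖ ^ α))
    {ξ : V} (hξ : R ≤ ‖ξ‖) :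
    ∫⁻ z, ENNReal.ofReal (min 1 |inner ℝ ξ z|) ∂ν ≤
      ENNReal.ofReal (25 / 2 * (C / (1 - α)) * ‖ξ‖ ^ α) := by
  have hα : 0 < 1 - α := by linarith
  have hmeas : Measurable fun p : V × ℝ =>
      ENNReal.ofReal ((1 - Real.cos (p.2 * inner ℝ ξ p.1)) * p.2 ^ (-2 : ℝ)) := by
    fun_prop
  calc ∫⁻ z, ENNReal.ofReal (min 1 |inner ℝ ξ z|) ∂ν
      ≤ ∫⁻ z, (ENNReal.ofReal (25 / 2) * ∫⁻ θ in Set.Ioi (1 : ℝ),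
          ENNReal.ofReal ((1 - Real.cos (θ * inner ℝ ξ z)) * θ ^ (-2 : ℝ))) ∂ν :=
        lintegral_mono fun z => min_one_le_lintegral_one_sub_cos _
    _ = ENNReal.ofReal (25 / 2) * ∫⁻ θ in Set.Ioi (1 : ℝ), (∫⁻ z,
          ENNReal.ofReal ((1 - Real.cos (θ * inner ℝ ξ z)) * θ ^ (-2 : ℝ)) ∂ν) := by
        rw [lintegral_const_mul _ (Measurable.lintegral_prod_right hmeas),
          lintegral_lintegral_swap hmeas.aemeasurable]
    _ ≤ ENNReal.ofReal (25 / 2) * ∫⁻ θ in Set.Ioi (1 : ℝ),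
          ENNReal.ofReal (C * ‖ξ‖ ^ α * θ ^ (α - 2)) := by
        gcongr ENNReal.ofReal (25 / 2) * ?_
        refine setLIntegral_mono (by fun_prop) fun θ hθ => ?_
        have hθ1 : 1 < θ := hθ
        have hθ0 : 0 < θ := by linarith
        -- Since `θ > 1`, dilated frequencies stay in the range of the hypothesis. The resulting
        -- weight `θ ^ (α - 2)` is integrable at infinity because `α < 1`.
        have h1 : R ≤ ‖θ • ξ‖ := by
          rw [norm_smul, Real.norm_of_nonneg hθ0.le]
          nlinarith [norm_nonneg ξ]
        have h2 := hν _ h1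
        simp_rw [inner_smul_left] at h2
        calc ∫⁻ z, ENNReal.ofReal ((1 - Real.cos (θ * inner ℝ ξ z)) * θ ^ (-2 : ℝ)) ∂ν
            = (∫⁻ z, ENNReal.ofReal (1 - Real.cos (θ * inner ℝ ξ z)) ∂ν) *
              ENNReal.ofReal (θ ^ (-2 : ℝ)) := by
              rw [← lintegral_mul_const _ (by fun_prop)]
              exact lintegral_congr fun z => ENNReal.ofReal_mul' (by positivity)
          _ ≤ ENNReal.ofReal (C * ‖θ • ξ‖ ^ α) * ENNReal.ofReal (θ ^ (-2 : ℝ)) := by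
              gcongr
              exact h2
          _ = ENNReal.ofReal (C * ‖ξ‖ ^ α * θ ^ (α - 2)) := by
              rw [← ENNReal.ofReal_mul (by positivity), norm_smul, Real.norm_of_nonneg hθ0.le,
                Real.mul_rpow hθ0.le (norm_nonneg _), sub_eq_add_neg, Real.rpow_add hθ0]
              congr 1
              ring
    _ = ENNReal.ofReal (25 / 2 * (C / (1 - α)) * ‖ξ‖ ^ α) := by
        rw [← ofReal_integral_eq_lintegral_ofReal
          ((integrableOn_Ioi_rpow_of_lt (by linarith) one_pos).const_mul _), integral_const_mul,
          integral_Ioi_rpow_of_lt (by linarith) one_pos, ← ENNReal.ofReal_mul (by norm_num)]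
        · congr 1
          rw [Real.one_rpow, show α - 2 + 1 = -(1 - α) by ring, neg_div_neg_eq]
          ring
        · filter_upwards [ae_restrict_mem measurableSet_Ioi] with θ hθ
          have hθ0 : 0 < θ := one_pos.trans hθ
          positivity

end LevyMeasureBound

end CBI

namespace CBI

/-! ### Exponential tilting on the orthant. -/

section Orthant

variable {d : ℕ}

/-- The orthant as an additive submonoid. -/
def orthantSubmonoid (d : ℕ) : AddSubmonoid (EuclideanSpace ℝ (Fin d)) where
  carrier := orthant d
  zero_mem' := fun j => by simp
  add_mem' := fun {x y} hx hy j => by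
    rw [PiLp.add_apply]
    exact add_nonneg (hx j) (hy j)

theorem isClosed_orthant : IsClosed (orthant d) := by
  have : orthant d = ⋂ j, {x : EuclideanSpace ℝ (Fin d) | 0 ≤ x j} := by
    ext x
    simp only [Set.mem_iInter]
    exact Iff.rfl
  rw [this]
  exact isClosed_iInter fun j => isClosed_le continuous_const (by fun_prop)

/-- The weight dominating the tilted densities. -/
noncomputable def expWeight (z : EuclideanSpace ℝ (Fin d)) : ℝ :=
  ∏ j, (Set.Ici (-1 : ℝ)).indicator (fun u => Real.exp (-u)) (z j)

theorem expWeight_nonneg (z : EuclideanSpace ℝ (Fin d)) : 0 ≤ expWeight z :=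
  Finset.prod_nonneg fun _ _ => Set.indicator_nonneg (fun _ _ => (Real.exp_pos _).le) _

theorem expWeight_of_le {z : EuclideanSpace ℝ (Fin d)} (hz : ∀ j, -1 ≤ z j) :
    expWeight z = Real.exp (-∑ j, z j) := by
  rw [expWeight, ← Finset.sum_neg_distrib, Real.exp_sum]
  exact Finset.prod_congr rfl fun j _ => Set.indicator_of_mem (Set.mem_Ici.2 (hz j)) _

theorem integrable_expWeight : Integrable (expWeight (d := d)) := by
  have h1 : Integrable ((Set.Ici (-1 : ℝ)).indicator fun u => Real.exp (-u)) := by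
    rw [integrable_indicator_iff measurableSet_Ici, integrableOn_Ici_iff_integrableOn_Ioi]
    simpa using integrableOn_exp_mul_Ioi (neg_lt_zero.2 one_pos) (-1)
  have h2 : Integrable fun x : Fin d → ℝ =>
      ∏ j, (Set.Ici (-1 : ℝ)).indicator (fun u => Real.exp (-u)) (x j) :=
    Integrable.fintype_prod fun _ => h1
  exact (PiLp.volume_preserving_ofLp (Fin d)).integrable_comp_of_integrable h2

/-- The exponential tilt of a bounded Lipschitz density on the orthant has a Lipschitz `L¹`
modulus of continuity. -/
theorem integral_abs_translate_sub_tilt_le {f : EuclideanSpace ℝ (Fin d) → ℝ} {A L M s : ℝ}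
    (hf0 : ∀ z, 0 ≤ f z) (hfA : ∀ z, f z ≤ A)
    (hfL : ∀ z h, |f (z + h) - f z| ≤ L * ‖h‖) (hsupp : ∀ᵐ z, z ∉ orthant d → f z = 0)
    (hs : 0 < s) (hM : 0 ≤ M)
    (hint : Integrable fun z => M * Real.exp (-(s * ∑ j, z j)) * f z)
    (hone : ∫ z, M * Real.exp (-(s * ∑ j, z j)) * f z = 1) (i : Fin d) (h : ℝ) :
    ∫ z, |M * Real.exp (-(s * ∑ j, (z + h • EuclideanSpace.single i (1 : ℝ)) j)) *
        f (z + h • EuclideanSpace.single i (1 : ℝ)) - M * Real.exp (-(s * ∑ j, z j)) * f z| ≤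
      (2 * s + M * (2 * s * A + L) * (s ^ d)⁻¹ * ∫ z, expWeight (d := d) z) * |h| := by
  set e := h • EuclideanSpace.single i (1 : ℝ) with he
  have hA : 0 ≤ A := (hf0 0).trans (hfA 0)
  have hL : 0 ≤ L := by
    have h1 := (abs_nonneg _).trans (hfL 0 (EuclideanSpace.single i (1 : ℝ)))
    simpa using h1
  have hJ : 0 ≤ ∫ z, expWeight (d := d) z := integral_nonneg expWeight_nonneg
  have hp0 : ∀ z, 0 ≤ M * Real.exp (-(s * ∑ j, z j)) * f z := fun z =>
    mul_nonneg (mul_nonneg hM (Real.exp_pos _).le) (hf0 z)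
  -- For shifts beyond the length scale `1/s` the trivial bound 2 is already at most `2 s |h|`.
  -- Shorter shifts move a point of the orthant by at most one unit after rescaling by `s`, which is
  -- why the weight is supported on coordinates at least `-1`.
  rcases lt_or_ge (1 / s) |h| with hbig | hsmall
  · have h1 := integral_abs_translate_sub_le hint e
    simp_rw [fun z => abs_of_nonneg (hp0 z)] at h1
    rw [hone] at h1
    refine h1.trans ?_
    rw [div_lt_iff₀ hs] at hbig
    have h2 : 0 ≤ M * (2 * s * A + L) * (s ^ d)⁻¹ * ∫ z, expWeight (d := d) z := by positivity
    nlinarith [abs_nonneg h]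
  · have hhs : |s * h| ≤ 1 := by
      rw [abs_mul, abs_of_pos hs, mul_comm]
      rwa [le_div_iff₀ hs] at hsmall
    have hee : ‖e‖ = |h| := by rw [he, norm_smul]; simp
    have hej : ∀ j, -|h| ≤ e j ∧ e j ≤ |h| := by
      intro j
      rw [← abs_le, ← hee]
      exact PiLp.norm_apply_le e j
    have hesum : ∑ j, e j = h := by
      simp [he, PiLp.smul_apply]
    have hsupp' : ∀ᵐ z, z + e ∉ orthant d → f (z + e) = 0 :=
      (measurePreserving_add_right volume e).quasiMeasurePreserving.ae hsupp
    have hexp : |Real.exp (-(s * h)) - 1| ≤ 2 * s * |h| := by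
      have := Real.abs_exp_sub_one_le (x := -(s * h)) (by rwa [abs_neg])
      rwa [abs_neg, abs_mul, abs_of_pos hs, ← mul_assoc] at this
    have hbound : ∀ᵐ z, |M * Real.exp (-(s * ∑ j, (z + e) j)) * f (z + e) -
        M * Real.exp (-(s * ∑ j, z j)) * f z| ≤
        M * (2 * s * A + L) * |h| * expWeight (s • z) := by
      filter_upwards [hsupp, hsupp'] with z hz hz'
      by_cases hout : z ∉ orthant d ∧ z + e ∉ orthant d
      · rw [hz hout.1, hz' hout.2]
        simp only [mul_zero, sub_zero, abs_zero]
        have := expWeight_nonneg (s • z)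
        positivity
      · have hge : ∀ j, -1 ≤ (s • z) j := by
          intro j
          rw [PiLp.smul_apply, smul_eq_mul]
          have h1 : -|h| ≤ z j := by
            by_cases hzo : z ∈ orthant d
            · linarith [hzo j, abs_nonneg h]
            · have h2 : z + e ∈ orthant d := by
                by_contra h3
                exact hout ⟨hzo, h3⟩
              have h3 := h2 j
              rw [PiLp.add_apply] at h3
              linarith [(hej j).2]
          rw [abs_mul, abs_of_pos hs] at hhs
          nlinarith
        rw [expWeight_of_le hge]
        have hsum : ∑ j, (s • z) j = s * ∑ j, z j := by
          rw [Finset.mul_sum]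
          rfl
        have hsum' : ∑ j, (z + e) j = ∑ j, z j + h := by
          simp only [PiLp.add_apply, Finset.sum_add_distrib, hesum]
        rw [hsum, hsum', mul_add, neg_add, Real.exp_add]
        set E := Real.exp (-(s * ∑ j, z j)) with hE
        have hE0 : 0 < E := Real.exp_pos _
        have h1 : M * (E * Real.exp (-(s * h))) * f (z + e) - M * E * f z =
            M * E * ((Real.exp (-(s * h)) - 1) * f (z + e) + (f (z + e) - f z)) := by ring
        have h2 : |(Real.exp (-(s * h)) - 1) * f (z + e) + (f (z + e) - f z)| ≤
            (2 * s * |h|) * A + L * |h| := by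
          refine (abs_add_le _ _).trans (add_le_add ?_ ?_)
          · rw [abs_mul, abs_of_nonneg (hf0 _)]
            exact mul_le_mul hexp (hfA _) (hf0 _) (by positivity)
          · rw [← hee]
            exact hfL z e
        rw [h1, abs_mul, abs_of_nonneg (by positivity : 0 ≤ M * E)]
        calc M * E * |(Real.exp (-(s * h)) - 1) * f (z + e) + (f (z + e) - f z)|
            ≤ M * E * ((2 * s * |h|) * A + L * |h|) := by gcongr
          _ = M * (2 * s * A + L) * |h| * E := by ring
    have hWs : Integrable fun z : EuclideanSpace ℝ (Fin d) => expWeight (s • z) :=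
      integrable_expWeight.comp_smul hs.ne'
    calc ∫ z, |M * Real.exp (-(s * ∑ j, (z + e) j)) * f (z + e) -
          M * Real.exp (-(s * ∑ j, z j)) * f z|
        ≤ ∫ z, M * (2 * s * A + L) * |h| * expWeight (s • z) :=
          integral_mono_ae ((hint.comp_add_right e).sub hint).abs (hWs.const_mul _) hbound
      _ = M * (2 * s * A + L) * (s ^ d)⁻¹ * (∫ z, expWeight (d := d) z) * |h| := by
          rw [integral_const_mul, Measure.integral_comp_smul, finrank_euclideanSpace_fin,
            abs_of_pos (by positivity : 0 < (s ^ d)⁻¹), smul_eq_mul]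
          ring
      _ ≤ _ := by
          gcongr
          linarith

end Orthant

/-! ### Moments of stretched exponentials and the density of the tilted law. -/

section StretchedExponential

/-- For `x ≥ 1`, use `u ^ N / N! ≤ exp u` at `u = c x ^ α` with `N α ≥ m`. -/
theorem exists_pow_mul_exp_neg_rpow_le {α c : ℝ} (hα : 0 < α) (hc : 0 < c) (m : ℕ) :
    ∃ C : ℝ, ∀ x : ℝ, 0 ≤ x → (1 + x) ^ m * Real.exp (-(c * x ^ α)) ≤ C := by
  obtain ⟨N, hN⟩ := exists_nat_ge ((m : ℝ) / α)
  rw [div_le_iff₀ hα] at hN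
  refine ⟨2 ^ m + 2 ^ m * (N.factorial / c ^ N), fun x hx => ?_⟩
  have hxα : 0 ≤ c * x ^ α := by positivity
  rcases le_total x 1 with h | h
  · calc (1 + x) ^ m * Real.exp (-(c * x ^ α)) ≤ 2 ^ m * 1 := by
          gcongr
          · linarith
          · exact Real.exp_le_one_iff.2 (by linarith)
      _ ≤ _ := by
          rw [mul_one]
          have : (0 : ℝ) ≤ 2 ^ m * (N.factorial / c ^ N) := by positivity
          linarith
  · have h0 : 0 < x := by linarith
    have h1 : (c * x ^ α) ^ N / N.factorial ≤ Real.exp (c * x ^ α) :=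
      Real.pow_div_factorial_le_exp _ hxα N
    have h2 : x ^ m ≤ (x ^ α) ^ N := by
      rw [← Real.rpow_natCast, ← Real.rpow_natCast, ← Real.rpow_mul hx, mul_comm α]
      exact Real.rpow_le_rpow_of_exponent_le h hN
    have h3 : Real.exp (-(c * x ^ α)) ≤ N.factorial / (c ^ N * x ^ m) := by
      rw [Real.exp_neg, inv_le_comm₀ (Real.exp_pos _) (by positivity), inv_div]
      refine le_trans ?_ h1
      rw [mul_pow]
      gcongr
    calc (1 + x) ^ m * Real.exp (-(c * x ^ α))
        ≤ (2 * x) ^ m * (N.factorial / (c ^ N * x ^ m)) := by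
          gcongr
          linarith
      _ = 2 ^ m * (N.factorial / c ^ N) := by
          rw [mul_pow]
          field_simp
      _ ≤ _ := by
          have : (0 : ℝ) ≤ 2 ^ m := by positivity
          linarith

variable {V : Type*} [NormedAddCommGroup V] [InnerProductSpace ℝ V] [FiniteDimensional ℝ V]
  [MeasurableSpace V] [BorelSpace V]

theorem integrable_pow_norm_mul_exp_neg_rpow {α c : ℝ} (hα : 0 < α) (hc : 0 < c) (k : ℕ) :
    Integrable fun w : V => ‖w‖ ^ k * Real.exp (-(c * ‖w‖ ^ α)) := by
  set n := Module.finrank ℝ V with hn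
  obtain ⟨C, hC⟩ := exists_pow_mul_exp_neg_rpow_le hα hc (k + (n + 1))
  have h1 : Integrable fun w : V => C * (1 + ‖w‖) ^ (-((n : ℝ) + 1)) :=
    (integrable_one_add_norm (by rw [← hn]; linarith)).const_mul C
  have hcont : Continuous fun w : V => ‖w‖ ^ k * Real.exp (-(c * ‖w‖ ^ α)) := by
    have := Real.continuous_rpow_const hα.le
    fun_prop
  refine h1.mono' hcont.aestronglyMeasurable (Eventually.of_forall fun w => ?_)
  have hw : 0 < 1 + ‖w‖ := by positivity
  rw [Real.norm_of_nonneg (by positivity), Real.rpow_neg hw.le, ← div_eq_mul_inv,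
    le_div_iff₀ (by positivity), ← Nat.cast_add_one, Real.rpow_natCast]
  refine le_trans ?_ (hC ‖w‖ (norm_nonneg w))
  rw [pow_add _ k, mul_right_comm]
  gcongr
  linarith

theorem integral_pow_norm_mul_exp_neg_rpow_smul {α c s : ℝ} (hs : 0 < s) (k : ℕ) :
    ∫ w : V, ‖w‖ ^ k * Real.exp (-(c * ‖s⁻¹ • w‖ ^ α)) =
      s ^ (k + Module.finrank ℝ V) * ∫ w : V, ‖w‖ ^ k * Real.exp (-(c * ‖w‖ ^ α)) := by
  have h1 : ∀ w : V, ‖w‖ ^ k * Real.exp (-(c * ‖s⁻¹ • w‖ ^ α)) =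
      s ^ k * (‖s⁻¹ • w‖ ^ k * Real.exp (-(c * ‖s⁻¹ • w‖ ^ α))) := by
    intro w
    have h2 : ‖w‖ = s * ‖s⁻¹ • w‖ := by
      rw [norm_smul, norm_inv, Real.norm_of_nonneg hs.le, mul_inv_cancel_left₀ hs.ne']
    nth_rewrite 1 [h2]
    ring
  simp_rw [h1]
  rw [integral_const_mul, Measure.integral_comp_smul volume
    (fun w : V => ‖w‖ ^ k * Real.exp (-(c * ‖w‖ ^ α))), abs_of_pos (by positivity), smul_eq_mul]
  rw [inv_pow, inv_inv, pow_add]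
  ring

end StretchedExponential

/-- The exponential tilt of a law on the orthant whose characteristic function decays like a
stretched exponential has a density with a Lipschitz `L¹` modulus of continuity. -/
theorem exists_tilted_density {d : ℕ} {α c : ℝ} (hα : 0 < α) (hc : 0 < c) (M₀ M₁ : ℝ) :
    ∃ C : ℝ, 0 < C ∧ ∀ (s M : ℝ) (Q : Measure (EuclideanSpace ℝ (Fin d))), 0 < s → 0 ≤ M →
      M ≤ M₁ → IsProbabilityMeasure Q → Q (orthant d)ᶜ = 0 →
      (∀ ξ, ‖charFun Q ξ‖ ≤ M₀ * Real.exp (-(c * ‖s⁻¹ • ξ‖ ^ α))) →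
      IsProbabilityMeasure (Q.withDensity fun z =>
        ENNReal.ofReal (M * Real.exp (-(s * ∑ j, z j)))) →
      ∃ p : EuclideanSpace ℝ (Fin d) → ℝ, Measurable p ∧ (∀ z, 0 ≤ p z) ∧
        (Q.withDensity fun z => ENNReal.ofReal (M * Real.exp (-(s * ∑ j, z j)))) =
          volume.withDensity (fun z => ENNReal.ofReal (p z)) ∧
        ∀ (i : Fin d) (h : ℝ),
          ∫ z, |p (z + h • EuclideanSpace.single i (1 : ℝ)) - p z| ≤ C * s * |h| := by
  set I₀ := ∫ w : EuclideanSpace ℝ (Fin d), ‖w‖ ^ 0 * Real.exp (-(c * ‖w‖ ^ α)) with hI₀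
  set I₁ := ∫ w : EuclideanSpace ℝ (Fin d), ‖w‖ ^ 1 * Real.exp (-(c * ‖w‖ ^ α)) with hI₁
  set J := ∫ z, expWeight (d := d) z with hJ
  have hI₀0 : 0 ≤ I₀ := integral_nonneg fun w => by positivity
  have hI₁0 : 0 ≤ I₁ := integral_nonneg fun w => by positivity
  have hJ0 : 0 ≤ J := integral_nonneg expWeight_nonneg
  -- `I₀ s ^ d` and `I₁ s ^ (d + 1)` come from the zeroth and first moments of the Fourier bound,
  -- and `J s ^ (-d)` is the mass of the rescaled weight; one factor `s` survives. Absolute values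
  -- appear because no sign is assumed on `M₀` and `M₁`.
  refine ⟨2 + |M₁| * (2 * (|M₀| * I₀) + 2 * Real.pi * (|M₀| * I₁)) * J, by positivity, ?_⟩
  intro s M Q hs hM hMM hQ hQK hdecay hP
  have hcs : ∀ k : ℕ, Integrable fun w : EuclideanSpace ℝ (Fin d) =>
      |M₀| * (‖w‖ ^ k * Real.exp (-(c * ‖s⁻¹ • w‖ ^ α))) := by
    intro k
    have h1 : ∀ w : EuclideanSpace ℝ (Fin d), ‖s⁻¹ • w‖ ^ α = (s⁻¹) ^ α * ‖w‖ ^ α := fun w => by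
      rw [norm_smul, norm_inv, Real.norm_of_nonneg hs.le,
        Real.mul_rpow (by positivity) (norm_nonneg _)]
    simp_rw [h1, ← mul_assoc c]
    exact (integrable_pow_norm_mul_exp_neg_rpow hα (by positivity) k).const_mul _
  have hψ : ∀ w : EuclideanSpace ℝ (Fin d), ‖fourierMeasure Q w‖ ≤ |M₀| * Real.exp (-(c * ‖s⁻¹ • w‖ ^ α)) := by
    intro w
    refine (hdecay _).trans ?_
    -- The factor `2π` of the Fourier normalization only improves the decay and is dropped.
    have h1 : ‖s⁻¹ • w‖ ≤ ‖s⁻¹ • -((2 * Real.pi) • w)‖ := by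
      rw [smul_neg, norm_neg, smul_comm, norm_smul (2 * Real.pi),
        Real.norm_of_nonneg (by positivity)]
      nlinarith [Real.pi_gt_three, norm_nonneg (s⁻¹ • w)]
    have h2 := Real.rpow_le_rpow (norm_nonneg _) h1 hα.le
    refine mul_le_mul (le_abs_self _) ?_ (Real.exp_pos _).le (abs_nonneg _)
    gcongr
  have hψm : Measurable (fourierMeasure Q) := by
    unfold fourierMeasure
    fun_prop
  have hψint : Integrable (fourierMeasure Q) := by
    refine (hcs 0).mono' hψm.aestronglyMeasurable (Eventually.of_forall fun w => ?_)
    simpa using hψ w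
  have hψ1 : ∀ w : EuclideanSpace ℝ (Fin d), ‖w‖ * ‖fourierMeasure Q w‖ ≤
      |M₀| * (‖w‖ ^ 1 * Real.exp (-(c * ‖s⁻¹ • w‖ ^ α))) := by
    intro w
    have := mul_le_mul_of_nonneg_left (hψ w) (norm_nonneg w)
    rw [pow_one]
    linarith
  have hψint1 : Integrable fun w => ‖w‖ * ‖fourierMeasure Q w‖ := by
    refine (hcs 1).mono' (by fun_prop) (Eventually.of_forall fun w => ?_)
    rw [Real.norm_of_nonneg (by positivity)]
    exact hψ1 w
  have hB₀ : ∫ w, ‖fourierMeasure Q w‖ ≤ |M₀| * I₀ * s ^ d := by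
    calc ∫ w, ‖fourierMeasure Q w‖
        ≤ ∫ w : EuclideanSpace ℝ (Fin d), |M₀| * (‖w‖ ^ 0 * Real.exp (-(c * ‖s⁻¹ • w‖ ^ α))) :=
          integral_mono hψint.norm (hcs 0) fun w => by simpa using hψ w
      _ = |M₀| * I₀ * s ^ d := by
          rw [integral_const_mul, integral_pow_norm_mul_exp_neg_rpow_smul hs,
            finrank_euclideanSpace_fin, ← hI₀]
          ring
  have hB₁ : ∫ w, ‖w‖ * ‖fourierMeasure Q w‖ ≤ |M₀| * I₁ * s ^ (d + 1) := by
    calc ∫ w, ‖w‖ * ‖fourierMeasure Q w‖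
        ≤ ∫ w : EuclideanSpace ℝ (Fin d), |M₀| * (‖w‖ ^ 1 * Real.exp (-(c * ‖s⁻¹ • w‖ ^ α))) :=
          integral_mono hψint1 (hcs 1) hψ1
      _ = |M₀| * I₁ * s ^ (d + 1) := by
          rw [integral_const_mul, integral_pow_norm_mul_exp_neg_rpow_smul hs,
            finrank_euclideanSpace_fin, ← hI₁]
          ring
  obtain ⟨f, hfc, hf0, hQf, hff⟩ := exists_density_of_integrable_fourierMeasure Q hψint
  have hfA : ∀ z, f z ≤ |M₀| * I₀ * s ^ d := by
    intro z
    refine le_trans ?_ ((norm_fourierInv_le (fourierMeasure Q) z).trans hB₀)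
    rw [← hff z, Complex.norm_real]
    exact le_abs_self _
  have hfL : ∀ z h, |f (z + h) - f z| ≤ (2 * Real.pi * (|M₀| * I₁ * s ^ (d + 1))) * ‖h‖ := by
    intro z h
    have h1 := norm_fourierInv_add_sub_le hψint hψint1 z h
    rw [← hff, ← hff, ← Complex.ofReal_sub, Complex.norm_real, Real.norm_eq_abs] at h1
    refine h1.trans ?_
    calc 2 * Real.pi * ‖h‖ * ∫ w, ‖w‖ * ‖fourierMeasure Q w‖
        ≤ 2 * Real.pi * ‖h‖ * (|M₀| * I₁ * s ^ (d + 1)) := by gcongr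
      _ = _ := by ring
  have hsupp : ∀ᵐ z, z ∉ orthant d → f z = 0 := by
    have h1 : ∫⁻ z in (orthant d)ᶜ, ENNReal.ofReal (f z) = 0 := by
      rw [← withDensity_apply _ isClosed_orthant.measurableSet.compl, ← hQf, hQK]
    rw [lintegral_eq_zero_iff (by fun_prop), Filter.EventuallyEq,
      ae_restrict_iff' isClosed_orthant.measurableSet.compl] at h1
    filter_upwards [h1] with z hz hzo
    have h2 := hz hzo
    rw [Pi.zero_apply, ENNReal.ofReal_eq_zero] at h2
    exact le_antisymm h2 (hf0 z)
  set p : EuclideanSpace ℝ (Fin d) → ℝ := fun z => M * Real.exp (-(s * ∑ j, z j)) * f z with hp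
  have hp0 : ∀ z, 0 ≤ p z := fun z => mul_nonneg (mul_nonneg hM (Real.exp_pos _).le) (hf0 z)
  have hpm : Measurable p := by fun_prop
  have hPp : (Q.withDensity fun z => ENNReal.ofReal (M * Real.exp (-(s * ∑ j, z j)))) =
      volume.withDensity (fun z => ENNReal.ofReal (p z)) := by
    rw [hQf, ← withDensity_mul _ (by fun_prop) (by fun_prop)]
    congr 1
    ext z
    rw [Pi.mul_apply, ← ENNReal.ofReal_mul (hf0 z), hp, mul_comm]
  have hPp' : IsProbabilityMeasure (volume.withDensity fun z => ENNReal.ofReal (p z)) := by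
    rwa [← hPp]
  have hpint : Integrable p := integrable_of_isFiniteMeasure_withDensity hpm hp0 inferInstance
  have hpone : ∫ z, p z = 1 := by
    have h1 : (volume.withDensity fun z => ENNReal.ofReal (p z)) Set.univ = 1 := measure_univ
    rw [withDensity_apply _ MeasurableSet.univ, setLIntegral_univ] at h1
    rw [integral_eq_lintegral_of_nonneg_ae (Eventually.of_forall hp0) hpm.aestronglyMeasurable, h1,
      ENNReal.toReal_one]
  refine ⟨p, hpm, hp0, hPp, fun i h => ?_⟩
  refine (integral_abs_translate_sub_tilt_le hf0 hfA hfL hsupp hs hM hpint hpone i h).trans ?_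
  gcongr
  have h1 : M * (2 * s * (|M₀| * I₀ * s ^ d) + 2 * Real.pi * (|M₀| * I₁ * s ^ (d + 1))) *
      (s ^ d)⁻¹ * J = M * (2 * (|M₀| * I₀) + 2 * Real.pi * (|M₀| * I₁)) * J * s := by
    rw [pow_succ]
    field_simp
  rw [h1, add_mul]
  gcongr
  exact hMM.trans (le_abs_self _)

end CBI

namespace CBI

/-! ### Tilted characters of the orthant. -/

section TiltedCharacter

variable {d : ℕ}

/-- The character `z ↦ exp(i ⟨z, ξ⟩ - s ∑ z_j)` of the orthant, extended to a bounded function. -/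
noncomputable def tiltChar (s : ℝ) (hs : 0 ≤ s) (ξ : EuclideanSpace ℝ (Fin d)) :
    BoundedContinuousFunction (EuclideanSpace ℝ (Fin d)) ℂ :=
  BoundedContinuousFunction.ofNormedAddCommGroup
    (fun z => Complex.exp (inner ℝ z ξ * Complex.I) *
      (Real.exp (-(s * ∑ j, max (z j) 0)) : ℂ)) (by fun_prop) 1 fun z => by
    rw [norm_mul, Complex.norm_exp_ofReal_mul_I, one_mul, Complex.norm_real,
      Real.norm_of_nonneg (Real.exp_pos _).le, Real.exp_le_one_iff, neg_nonpos]
    exact mul_nonneg hs (Finset.sum_nonneg fun j _ => le_max_right _ _)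

theorem tiltChar_apply {s : ℝ} (hs : 0 ≤ s) (ξ : EuclideanSpace ℝ (Fin d))
    {z : EuclideanSpace ℝ (Fin d)} (hz : z ∈ orthant d) :
    tiltChar s hs ξ z = Complex.exp (inner ℝ z ξ * Complex.I) *
      (Real.exp (-(s * ∑ j, z j)) : ℂ) := by
  have h1 : ∑ j, max (z j) 0 = ∑ j, z j := Finset.sum_congr rfl fun j _ => max_eq_left (hz j)
  change Complex.exp (inner ℝ z ξ * Complex.I) * (Real.exp (-(s * ∑ j, max (z j) 0)) : ℂ) = _
  rw [h1]

/-- The truncation `max (z j) 0`, needed for boundedness on the whole space, is invisible on the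
orthant, where the exponent is additive. -/
theorem isCharOn_tiltChar {s : ℝ} (hs : 0 ≤ s) (ξ : EuclideanSpace ℝ (Fin d)) :
    IsCharOn (orthantSubmonoid d) (tiltChar s hs ξ) := by
  refine ⟨?_, fun x hx y hy => ?_⟩
  · rw [tiltChar_apply hs ξ (orthantSubmonoid d).zero_mem]
    simp
  · rw [tiltChar_apply hs ξ ((orthantSubmonoid d).add_mem hx hy), tiltChar_apply hs ξ hx,
      tiltChar_apply hs ξ hy]
    simp only [PiLp.add_apply, Finset.sum_add_distrib, mul_add, neg_add, Real.exp_add,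
      inner_add_left, Complex.ofReal_add, add_mul, Complex.exp_add, Complex.ofReal_mul]
    ring

theorem one_sub_exp_neg_sum_le {s : ℝ} (hs : 0 ≤ s) {z : EuclideanSpace ℝ (Fin d)}
    (hz : z ∈ orthant d) :
    1 - Real.exp (-(s * ∑ j, z j)) ≤ min 1 (s * ∑ j, z j) ∧
      0 ≤ 1 - Real.exp (-(s * ∑ j, z j)) := by
  have h0 : 0 ≤ s * ∑ j, z j := mul_nonneg hs (Finset.sum_nonneg fun j _ => hz j)
  refine ⟨le_min ?_ ?_, ?_⟩
  · linarith [Real.exp_pos (-(s * ∑ j, z j))]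
  · linarith [Real.add_one_le_exp (-(s * ∑ j, z j))]
  · linarith [Real.exp_le_one_iff.2 (neg_nonpos.2 h0)]

theorem one_sub_exp_neg_sum_le_mul_min {s : ℝ} (hs : 0 ≤ s) {z : EuclideanSpace ℝ (Fin d)}
    (hz : z ∈ orthant d) :
    1 - Real.exp (-(s * ∑ j, z j)) ≤ (1 + s * d) * min 1 ‖z‖ := by
  have h1 := (one_sub_exp_neg_sum_le hs hz).1
  have hsum : ∑ j, z j ≤ d * ‖z‖ := by
    calc ∑ j, z j ≤ ∑ _j : Fin d, ‖z‖ :=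
          Finset.sum_le_sum fun j _ => (le_abs_self _).trans (PiLp.norm_apply_le z j)
      _ = d * ‖z‖ := by simp
  have hd : (0 : ℝ) ≤ s * d := by positivity
  rcases le_total 1 ‖z‖ with h | h
  · rw [min_eq_left h]
    linarith [min_le_left 1 (s * ∑ j, z j)]
  · rw [min_eq_right h]
    nlinarith [min_le_right 1 (s * ∑ j, z j), mul_le_mul_of_nonneg_left hsum hs, norm_nonneg z]

theorem norm_tiltChar_sub_one_le {s : ℝ} (hs : 0 ≤ s) (ξ : EuclideanSpace ℝ (Fin d))
    {z : EuclideanSpace ℝ (Fin d)} (hz : z ∈ orthant d) :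
    ‖tiltChar s hs ξ z - 1‖ ≤ (2 + ‖ξ‖ + (1 + s * d)) * min 1 ‖z‖ := by
  have h1 := one_sub_exp_neg_sum_le_mul_min hs hz
  have h0 := (one_sub_exp_neg_sum_le hs hz).2
  have h2 := norm_innerProbChar_sub_one_le ξ z
  rw [BoundedContinuousFunction.innerProbChar_apply] at h2
  rw [tiltChar_apply hs ξ hz]
  set a := Complex.exp (inner ℝ z ξ * Complex.I) with ha
  set b := Real.exp (-(s * ∑ j, z j)) with hb
  have h3 : a * (b : ℂ) - 1 = (a - 1) - a * ((1 - b : ℝ) : ℂ) := by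
    push_cast
    ring
  rw [h3]
  refine (norm_sub_le _ _).trans ?_
  rw [norm_mul, ha, Complex.norm_exp_ofReal_mul_I, one_mul, Complex.norm_real,
    Real.norm_of_nonneg h0, add_mul]
  exact add_le_add h2 h1

end TiltedCharacter

/-! ### Splitting the jump law into its tilt and a remainder. -/

section JumpPart

variable {d : ℕ}

/-- Weighting by `min 1 ‖z‖` gives a finite measure, and the weight can be inverted off the null set
`{0}`. Tonelli for `ν` relies on this. -/
theorem sFinite_of_integrable_min_one_norm {ν : Measure (EuclideanSpace ℝ (Fin d))}
    (hν : Integrable (fun z => min 1 ‖z‖) ν) (h0 : ν {0} = 0) : SFinite ν := by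
  have hm : Measurable fun z : EuclideanSpace ℝ (Fin d) => ENNReal.ofReal (min 1 ‖z‖) := by
    fun_prop
  have hfin : IsFiniteMeasure (ν.withDensity fun z => ENNReal.ofReal (min 1 ‖z‖)) :=
    isFiniteMeasure_withDensity_ofReal hν.2
  have h1 := withDensity_inv_same (μ := ν) hm ?_ (Eventually.of_forall fun _ => ENNReal.ofReal_ne_top)
  · rw [← h1]
    infer_instance
  · filter_upwards [compl_mem_ae_iff.2 h0] with z hz
    have hz' : 0 < ‖z‖ := norm_pos_iff.2 hz
    exact (ENNReal.ofReal_pos.2 (lt_min one_pos hz')).ne'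

variable {ν : Measure (EuclideanSpace ℝ (Fin d))}

theorem integrable_innerProbChar_sub_one (hν : Integrable (fun z => min 1 ‖z‖) ν)
    (ξ : EuclideanSpace ℝ (Fin d)) :
    Integrable (fun z => BoundedContinuousFunction.innerProbChar ξ z - 1) ν :=
  (hν.const_mul (2 + ‖ξ‖)).mono' (by fun_prop)
    (Eventually.of_forall fun z => norm_innerProbChar_sub_one_le ξ z)

theorem integrable_tiltChar_sub_one (hν : Integrable (fun z => min 1 ‖z‖) ν)
    (hνK : ν (orthant d)ᶜ = 0) {s : ℝ} (hs : 0 ≤ s) (ξ : EuclideanSpace ℝ (Fin d)) :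
    Integrable (fun z => tiltChar s hs ξ z - 1) ν := by
  refine (hν.const_mul (2 + ‖ξ‖ + (1 + s * d))).mono' (by fun_prop) ?_
  filter_upwards [mem_ae_iff.2 hνK] with z hz using norm_tiltChar_sub_one_le hs ξ hz

theorem re_innerProbChar_sub_one (ξ z : EuclideanSpace ℝ (Fin d)) :
    (BoundedContinuousFunction.innerProbChar ξ z - 1).re = -(1 - Real.cos (inner ℝ ξ z)) := by
  rw [BoundedContinuousFunction.innerProbChar_apply, Complex.sub_re, Complex.exp_ofReal_mul_I_re,
    Complex.one_re, real_inner_comm]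
  ring

theorem integrable_one_sub_cos (hν : Integrable (fun z => min 1 ‖z‖) ν)
    (ξ : EuclideanSpace ℝ (Fin d)) :
    Integrable (fun z => 1 - Real.cos (inner ℝ ξ z)) ν := by
  refine ((integrable_innerProbChar_sub_one hν ξ).re.neg).congr (Eventually.of_forall fun z => ?_)
  change -(BoundedContinuousFunction.innerProbChar ξ z - 1).re = _
  rw [re_innerProbChar_sub_one, neg_neg]

theorem norm_exp_integral_innerProbChar (hν : Integrable (fun z => min 1 ‖z‖) ν) (t : ℝ≥0)
    (ξ : EuclideanSpace ℝ (Fin d)) :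
    ‖Complex.exp (t * ∫ z, (BoundedContinuousFunction.innerProbChar ξ z - 1) ∂ν)‖ =
      Real.exp (-(t * ∫ z, (1 - Real.cos (inner ℝ ξ z)) ∂ν)) := by
  have h1 : (∫ z, (BoundedContinuousFunction.innerProbChar ξ z - 1) ∂ν).re =
      -∫ z, (1 - Real.cos (inner ℝ ξ z)) ∂ν := by
    have h2 := integral_re (𝕜 := ℂ) (integrable_innerProbChar_sub_one hν ξ)
    change ∫ z, (BoundedContinuousFunction.innerProbChar ξ z - 1).re ∂ν =
      (∫ z, (BoundedContinuousFunction.innerProbChar ξ z - 1) ∂ν).re at h2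
    rw [← h2, ← integral_neg]
    exact integral_congr_ae (Eventually.of_forall fun z => re_innerProbChar_sub_one ξ z)
  rw [Complex.norm_exp]
  congr 1
  have h3 : ((t : ℝ≥0) : ℂ) = ((t : ℝ) : ℂ) := rfl
  rw [h3, Complex.re_ofReal_mul, h1, mul_neg]

/-- The law with Lévy measure `t ν` factors into the exponential tilt with parameter `s` of itself
and a further infinitely divisible law. -/
theorem exists_tilt_factorization (hν : Integrable (fun z => min 1 ‖z‖) ν)
    (hνK : ν (orthant d)ᶜ = 0) (t : ℝ≥0) {s : ℝ} (hs : 0 ≤ s) :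
    ∃ Q S : Measure (EuclideanSpace ℝ (Fin d)), IsProbabilityMeasure Q ∧ IsProbabilityMeasure S ∧
      Q (orthant d)ᶜ = 0 ∧
      (∀ ξ, charFun Q ξ =
        Complex.exp (t * ∫ z, (BoundedContinuousFunction.innerProbChar ξ z - 1) ∂ν)) ∧
      IsProbabilityMeasure (Q.withDensity fun z => ENNReal.ofReal
        (Real.exp (t * ∫ y, (1 - Real.exp (-(s * ∑ j, y j))) ∂ν) *
          Real.exp (-(s * ∑ j, z j)))) ∧
      ∀ ξ, charFun (Q.withDensity fun z => ENNReal.ofReal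
        (Real.exp (t * ∫ y, (1 - Real.exp (-(s * ∑ j, y j))) ∂ν) *
          Real.exp (-(s * ∑ j, z j)))) ξ * charFun S ξ =
        Complex.exp (t * ∫ z, (BoundedContinuousFunction.innerProbChar ξ z - 1) ∂ν) := by
  have hK : IsClosed (orthantSubmonoid d : Set (EuclideanSpace ℝ (Fin d))) := isClosed_orthant
  have hνmem : ∀ᵐ z ∂ν, z ∈ orthant d := mem_ae_iff.2 hνK
  obtain ⟨Q, hQ, hQK, hQχ⟩ := exists_infinitelyDivisible hK (κ := t • ν)
    (hν.smul_measure_nnreal) (by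
      change (t • ν) (orthant d)ᶜ = 0
      rw [Measure.smul_apply, hνK, smul_zero])
  have hQmem : ∀ᵐ z ∂Q, z ∈ orthant d := mem_ae_iff.2 hQK
  -- The proportion of jumps of size `z` that tilting removes; the remainder law `S` restores them.
  set ρ : EuclideanSpace ℝ (Fin d) → ℝ≥0 :=
    fun z => (1 - Real.exp (-(s * ∑ j, z j))).toNNReal with hρ
  have hρm : Measurable ρ := by fun_prop
  set κ : Measure (EuclideanSpace ℝ (Fin d)) := t • ν.withDensity (fun z => (ρ z : ℝ≥0∞)) with hκ
  have hρ1 : ∀ z, (ρ z : ℝ) ≤ 1 := by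
    intro z
    rw [hρ, Real.coe_toNNReal']
    exact max_le (by linarith [Real.exp_pos (-(s * ∑ j, z j))]) zero_le_one
  have hρν : Integrable (fun z => min 1 ‖z‖) (ν.withDensity fun z => (ρ z : ℝ≥0∞)) := by
    rw [integrable_withDensity_iff_integrable_smul hρm]
    refine hν.mono' (by fun_prop) (Eventually.of_forall fun z => ?_)
    have h0 : 0 ≤ min 1 ‖z‖ := le_min zero_le_one (norm_nonneg z)
    rw [NNReal.smul_def, smul_eq_mul, norm_mul, Real.norm_of_nonneg h0,
      Real.norm_of_nonneg (ρ z).coe_nonneg]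
    exact mul_le_of_le_one_left h0 (hρ1 z)
  obtain ⟨S, hS, -, hSχ⟩ := exists_infinitelyDivisible hK (κ := κ) (hρν.smul_measure_nnreal) (by
    change (t • ν.withDensity (fun z => (ρ z : ℝ≥0∞))) (orthant d)ᶜ = 0
    rw [Measure.smul_apply, withDensity_absolutelyContinuous ν _ hνK, smul_zero])
  have hQchar : ∀ ξ, charFun Q ξ =
      Complex.exp (t * ∫ z, (BoundedContinuousFunction.innerProbChar ξ z - 1) ∂ν) := by
    intro ξ
    rw [charFun_eq_integral_innerProbChar, hQχ _ (isCharOn_innerProbChar _ ξ) _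
      fun z _ => norm_innerProbChar_sub_one_le ξ z, integral_smul_nnreal_measure]
    rfl
  have hSchar : ∀ ξ, charFun S ξ = Complex.exp (t * ∫ z,
      ((1 - Real.exp (-(s * ∑ j, z j)) : ℝ) : ℂ) *
        (BoundedContinuousFunction.innerProbChar ξ z - 1) ∂ν) := by
    intro ξ
    rw [charFun_eq_integral_innerProbChar, hSχ _ (isCharOn_innerProbChar _ ξ) _
      fun z _ => norm_innerProbChar_sub_one_le ξ z, integral_smul_nnreal_measure,
      integral_withDensity_eq_integral_smul hρm]
    have h1 : ∫ z, ρ z • (BoundedContinuousFunction.innerProbChar ξ z - 1) ∂ν =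
        ∫ z, ((1 - Real.exp (-(s * ∑ j, z j)) : ℝ) : ℂ) *
        (BoundedContinuousFunction.innerProbChar ξ z - 1) ∂ν := by
      refine integral_congr_ae ?_
      filter_upwards [hνmem] with z hz
      rw [NNReal.smul_def, hρ, Real.coe_toNNReal _ (one_sub_exp_neg_sum_le hs hz).2,
        Complex.real_smul]
    rw [h1]
    rfl
  set M : ℝ := Real.exp (t * ∫ y, (1 - Real.exp (-(s * ∑ j, y j))) ∂ν) with hM
  -- `M` is the reciprocal of the Laplace transform of `Q` at `(s, …, s)`, which is the integral of
  -- the tilted character of frequency zero.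
  have hMc : (M : ℂ) = Complex.exp (-(t * ∫ z, (tiltChar s hs 0 z - 1) ∂ν)) := by
    have h1 : ∫ z, (tiltChar s hs 0 z - 1) ∂ν =
        -((∫ y, (1 - Real.exp (-(s * ∑ j, y j))) ∂ν : ℝ) : ℂ) := by
      rw [← integral_complex_ofReal, ← integral_neg]
      refine integral_congr_ae ?_
      filter_upwards [hνmem] with z hz
      rw [tiltChar_apply hs 0 hz]
      simp
    rw [h1, hM, Complex.ofReal_exp]
    congr 1
    push_cast
    have h3 : ((t : ℝ≥0) : ℂ) = ((t : ℝ) : ℂ) := rfl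
    rw [h3]
    ring
  set P := Q.withDensity fun z => ENNReal.ofReal (M * Real.exp (-(s * ∑ j, z j))) with hP
  have hPchar : ∀ ξ, charFun P ξ = Complex.exp (-(t * ∫ z, (tiltChar s hs 0 z - 1) ∂ν)) *
      Complex.exp (t * ∫ z, (tiltChar s hs ξ z - 1) ∂ν) := by
    intro ξ
    have h1 := hQχ _ (isCharOn_tiltChar hs ξ) _ fun z hz => norm_tiltChar_sub_one_le hs ξ hz
    rw [integral_smul_nnreal_measure] at h1
    have h2 : Complex.exp (t * ∫ z, (tiltChar s hs ξ z - 1) ∂ν) = ∫ z, tiltChar s hs ξ z ∂Q := by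
      rw [h1]
      rfl
    rw [h2, ← hMc, charFun_apply, hP, integral_withDensity_eq_integral_toReal_smul (by fun_prop)
      (Eventually.of_forall fun _ => ENNReal.ofReal_lt_top), ← integral_const_mul]
    refine integral_congr_ae ?_
    filter_upwards [hQmem] with z hz
    rw [tiltChar_apply hs ξ hz, ENNReal.toReal_ofReal (by positivity), Complex.real_smul]
    push_cast
    ring
  have hPprob : IsProbabilityMeasure P := by
    have hint : Integrable (fun z => M * Real.exp (-(s * ∑ j, z j))) Q := by
      refine (integrable_const M).mono' (by fun_prop) ?_
      filter_upwards [hQmem] with z hz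
      rw [Real.norm_of_nonneg (by positivity)]
      refine mul_le_of_le_one_right (Real.exp_pos _).le ?_
      linarith [(one_sub_exp_neg_sum_le hs hz).2]
    have hfin : IsFiniteMeasure P := isFiniteMeasure_withDensity_ofReal hint.2
    have h1 := hPchar 0
    rw [charFun_zero, ← Complex.exp_add, neg_add_cancel, Complex.exp_zero] at h1
    have h2 : P.real Set.univ = 1 := by exact_mod_cast h1
    exact ⟨(ENNReal.toReal_eq_one_iff _).1 h2⟩
  refine ⟨Q, S, hQ, hS, hQK, hQchar, hPprob, fun ξ => ?_⟩
  rw [hPchar, hSchar, ← Complex.exp_add, ← Complex.exp_add]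
  congr 1
  have hi0 := integrable_tiltChar_sub_one hν hνK hs 0
  have hiξ := integrable_tiltChar_sub_one hν hνK hs ξ
  have hie := integrable_innerProbChar_sub_one hν ξ
  -- With `χ` the Fourier character and `E` the real exponential, `(1 - E)(χ - 1) = (χ - 1) + (E -
  -- 1) - (E χ - 1)`. The last two terms cancel the exponent of the tilted law.
  have h1 : ∫ z, ((1 - Real.exp (-(s * ∑ j, z j)) : ℝ) : ℂ) *
        (BoundedContinuousFunction.innerProbChar ξ z - 1) ∂ν =
      ∫ z, ((BoundedContinuousFunction.innerProbChar ξ z - 1) +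
        ((tiltChar s hs 0 z - 1) - (tiltChar s hs ξ z - 1))) ∂ν := by
    refine integral_congr_ae ?_
    filter_upwards [hνmem] with z hz
    rw [tiltChar_apply hs ξ hz, tiltChar_apply hs 0 hz,
      BoundedContinuousFunction.innerProbChar_apply]
    simp only [inner_zero_right, Complex.ofReal_zero, zero_mul, Complex.exp_zero, one_mul,
      Complex.ofReal_sub, Complex.ofReal_one]
    ring
  have hsub : Integrable (fun z => (tiltChar s hs 0 z - 1) - (tiltChar s hs ξ z - 1)) ν :=
    hi0.sub hiξ
  rw [h1, integral_add hie hsub, integral_sub hi0 hiξ]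
  ring

end JumpPart

end CBI

/-! ### The jump law at the scale `s = t ^ (-1/α)`. -/

namespace CBI

/-- On the orthant `s ∑ z_j` is the inner product of `z` with `ξ = (s, …, s)`, so
`lintegral_min_one_inner_le` applies at this `ξ`. Dimension zero is separate because `‖ξ‖ ≥ s` needs
a coordinate. -/
theorem integral_one_sub_exp_neg_sum_le {d : ℕ} {ν : Measure (EuclideanSpace ℝ (Fin d))}
    (hν : Integrable (fun z => min 1 ‖z‖) ν) (hν0 : ν {0} = 0) (hνK : ν (orthant d)ᶜ = 0)
    {α C R : ℝ} (hα₀ : 0 < α) (hα₁ : α < 1) (hC : 0 < C)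
    (hup : ∀ ξ : EuclideanSpace ℝ (Fin d), R ≤ ‖ξ‖ →
      ∫ z, (1 - Real.cos (inner ℝ ξ z)) ∂ν ≤ C * ‖ξ‖ ^ α) {s : ℝ} (hs : 0 < s) (hRs : R ≤ s) :
    ∫ z, (1 - Real.exp (-(s * ∑ j, z j))) ∂ν ≤
      25 / 2 * (C / (1 - α)) *
        ‖(WithLp.toLp 2 fun _ => 1 : EuclideanSpace ℝ (Fin d))‖ ^ α * s ^ α := by
  set v : EuclideanSpace ℝ (Fin d) := WithLp.toLp 2 fun _ => 1 with hv
  have hα : 0 < 1 - α := by linarith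
  have hνmem : ∀ᵐ z ∂ν, z ∈ orthant d := mem_ae_iff.2 hνK
  rcases Nat.eq_zero_or_pos d with rfl | hd
  · simp only [Finset.univ_eq_empty, Finset.sum_empty, mul_zero, neg_zero, Real.exp_zero, sub_self,
      integral_zero]
    positivity
  have hsf : SFinite ν := sFinite_of_integrable_min_one_norm hν hν0
  have hv1 : 1 ≤ ‖v‖ := by
    simpa [hv] using PiLp.norm_apply_le v ⟨0, hd⟩
  have hsv : ‖s • v‖ = s * ‖v‖ := by rw [norm_smul, Real.norm_of_nonneg hs.le]
  have hRv : R ≤ ‖s • v‖ := by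
    rw [hsv]
    nlinarith
  have hinner : ∀ z : EuclideanSpace ℝ (Fin d), inner ℝ (s • v) z = s * ∑ j, z j := by
    intro z
    rw [inner_smul_left, PiLp.inner_apply]
    simp [hv]
  have hup' : ∀ ξ : EuclideanSpace ℝ (Fin d), R ≤ ‖ξ‖ →
      ∫⁻ z, ENNReal.ofReal (1 - Real.cos (inner ℝ ξ z)) ∂ν ≤ ENNReal.ofReal (C * ‖ξ‖ ^ α) := by
    intro ξ hξ
    rw [← ofReal_integral_eq_lintegral_ofReal (integrable_one_sub_cos hν ξ)
      (Eventually.of_forall fun z => sub_nonneg.2 (Real.cos_le_one _))]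
    exact ENNReal.ofReal_le_ofReal (hup ξ hξ)
  have hmain := lintegral_min_one_inner_le ν hα₁ hC.le hup' hRv
  rw [integral_eq_lintegral_of_nonneg_ae (by
      filter_upwards [hνmem] with z hz using (one_sub_exp_neg_sum_le hs.le hz).2)
    (by fun_prop)]
  refine ENNReal.toReal_le_of_le_ofReal (by positivity) ?_
  calc ∫⁻ z, ENNReal.ofReal (1 - Real.exp (-(s * ∑ j, z j))) ∂ν
      ≤ ∫⁻ z, ENNReal.ofReal (min 1 |inner ℝ (s • v) z|) ∂ν := by
        refine lintegral_mono_ae ?_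
        filter_upwards [hνmem] with z hz
        rw [hinner]
        exact ENNReal.ofReal_le_ofReal ((one_sub_exp_neg_sum_le hs.le hz).1.trans
          (min_le_min le_rfl (le_abs_self _)))
    _ ≤ ENNReal.ofReal (25 / 2 * (C / (1 - α)) * ‖s • v‖ ^ α) := hmain
    _ = ENNReal.ofReal (25 / 2 * (C / (1 - α)) * ‖v‖ ^ α * s ^ α) := by
        rw [hsv, Real.mul_rpow hs.le (norm_nonneg v)]
        congr 1
        ring

/-- For small times the law with Lévy measure `t ν` is the convolution of a law with a density
whose `L¹` modulus of continuity is of order `t ^ (-1/α)`, and another law. -/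
theorem exists_density_factor {d : ℕ} {ν : Measure (EuclideanSpace ℝ (Fin d))}
    (hν : Integrable (fun z => min 1 ‖z‖) ν) (hν0 : ν {0} = 0) (hνK : ν (orthant d)ᶜ = 0)
    {α c C R : ℝ} (hα₀ : 0 < α) (hα₁ : α < 1) (hc : 0 < c) (hC : 0 < C)
    (hlow : ∀ ξ : EuclideanSpace ℝ (Fin d), R ≤ ‖ξ‖ →
      c * ‖ξ‖ ^ α ≤ ∫ z, (1 - Real.cos (inner ℝ ξ z)) ∂ν)
    (hup : ∀ ξ : EuclideanSpace ℝ (Fin d), R ≤ ‖ξ‖ →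
      ∫ z, (1 - Real.cos (inner ℝ ξ z)) ∂ν ≤ C * ‖ξ‖ ^ α) :
    ∃ C' : ℝ, 0 < C' ∧ ∃ t₀ : ℝ≥0, 0 < t₀ ∧ ∀ t : ℝ≥0, 0 < t → t < t₀ →
      ∃ (p : EuclideanSpace ℝ (Fin d) → ℝ) (S : Measure (EuclideanSpace ℝ (Fin d))),
        Measurable p ∧ (∀ z, 0 ≤ p z) ∧
        IsProbabilityMeasure (volume.withDensity fun z => ENNReal.ofReal (p z)) ∧
        IsProbabilityMeasure S ∧
        (∀ ξ, charFun (volume.withDensity fun z => ENNReal.ofReal (p z)) ξ * charFun S ξ =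
          Complex.exp (t * ∫ z, (BoundedContinuousFunction.innerProbChar ξ z - 1) ∂ν)) ∧
        ∀ (i : Fin d) (h : ℝ),
          ∫ z, |p (z + h • EuclideanSpace.single i (1 : ℝ)) - p z| ≤
            C' * (t : ℝ) ^ (-(1 / α)) * |h| := by
  set R' : ℝ := max R 1 with hR'
  have hR'0 : 0 < R' := lt_of_lt_of_le one_pos (le_max_right _ _)
  set B : ℝ := 25 / 2 * (C / (1 - α)) *
    ‖(WithLp.toLp 2 fun _ => 1 : EuclideanSpace ℝ (Fin d))‖ ^ α with hB
  obtain ⟨C', hC', htilt⟩ := exists_tilted_density (d := d) hα₀ hc (Real.exp c) (Real.exp B)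
  refine ⟨C', hC', (R' ^ (-α)).toNNReal, Real.toNNReal_pos.2 (by positivity), fun t ht htt => ?_⟩
  have ht0 : (0 : ℝ) < t := ht
  have htR : (t : ℝ) < R' ^ (-α) := Real.lt_toNNReal_iff_coe_lt.1 htt
  have htR' : t * R' ^ α ≤ 1 := by
    rw [Real.rpow_neg hR'0.le] at htR
    have h1 := mul_lt_mul_of_pos_right htR (Real.rpow_pos_of_pos hR'0 α)
    rw [inv_mul_cancel₀ (Real.rpow_pos_of_pos hR'0 α).ne'] at h1
    exact h1.le
  -- This scale makes `t s ^ α = 1`, so `M` is at most `exp B` for all times; `t < R' ^ (-α)`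
  -- ensures `s ≥ R`.
  set s : ℝ := (t : ℝ) ^ (-(1 / α)) with hs
  have hs0 : 0 < s := Real.rpow_pos_of_pos ht0 _
  have hsα : s ^ α = (t : ℝ)⁻¹ := by
    rw [hs, ← Real.rpow_mul ht0.le, neg_mul, one_div, inv_mul_cancel₀ hα₀.ne', Real.rpow_neg_one]
  have hRs : R ≤ s := by
    refine (le_max_left R 1).trans ?_
    have h1 : R' ^ α ≤ s ^ α := by
      rw [hsα, ← one_div, le_div_iff₀ ht0, mul_comm]
      exact htR'
    exact (Real.rpow_le_rpow_iff hR'0.le hs0.le hα₀).1 h1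
  have hscale : ∀ ξ : EuclideanSpace ℝ (Fin d), ‖s⁻¹ • ξ‖ ^ α = t * ‖ξ‖ ^ α := by
    intro ξ
    rw [norm_smul, norm_inv, Real.norm_of_nonneg hs0.le,
      Real.mul_rpow (inv_nonneg.2 hs0.le) (norm_nonneg _), Real.inv_rpow hs0.le, hsα, inv_inv]
  obtain ⟨Q, S, hQ, hS, hQK, hQchar, hPprob, hPS⟩ := exists_tilt_factorization hν hνK t hs0.le
  have hM : Real.exp (t * ∫ y, (1 - Real.exp (-(s * ∑ j, y j))) ∂ν) ≤ Real.exp B := by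
    refine Real.exp_le_exp.2 ?_
    have h1 := mul_le_mul_of_nonneg_left
      (integral_one_sub_exp_neg_sum_le hν hν0 hνK hα₀ hα₁ hC hup hs0 hRs) ht0.le
    rw [hsα, ← hB, mul_left_comm, mul_inv_cancel₀ ht0.ne', mul_one] at h1
    exact h1
  -- The prefactor `exp c` covers frequencies below `R`, where the symbol has no lower bound but `t
  -- ‖ξ‖ ^ α ≤ 1`.
  have hdecay : ∀ ξ, ‖charFun Q ξ‖ ≤ Real.exp c * Real.exp (-(c * ‖s⁻¹ • ξ‖ ^ α)) := by
    intro ξ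
    rw [hQchar, norm_exp_integral_innerProbChar hν, hscale, ← Real.exp_add, Real.exp_le_exp]
    rcases le_total R ‖ξ‖ with h | h
    · have h1 := mul_le_mul_of_nonneg_left (hlow ξ h) ht0.le
      linarith
    · have h1 : ‖ξ‖ ^ α ≤ R' ^ α :=
        Real.rpow_le_rpow (norm_nonneg _) (h.trans (le_max_left _ _)) hα₀.le
      have h2 : (t : ℝ) * ‖ξ‖ ^ α ≤ 1 := (mul_le_mul_of_nonneg_left h1 ht0.le).trans htR'
      have h3 : 0 ≤ (t : ℝ) * ∫ z, (1 - Real.cos (inner ℝ ξ z)) ∂ν :=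
        mul_nonneg ht0.le (integral_nonneg fun z => sub_nonneg.2 (Real.cos_le_one _))
      nlinarith
  obtain ⟨p, hpm, hp0, hPp, hmod⟩ := htilt s _ Q hs0 (Real.exp_pos _).le hM hQ hQK hdecay hPprob
  rw [hPp] at hPprob hPS
  exact ⟨p, S, hpm, hp0, hPprob, hS, hPS, hmod⟩

/-! ### The Gaussian and compensated parts, and the full noise. -/

section Noise

variable {d : ℕ} (p : AdmissibleParams d)

theorem restrict_orthant_ν : p.ν.restrict (orthant d) = p.ν := by
  have h : ∀ᵐ z ∂p.ν, z ∈ orthant d := mem_ae_iff.2 p.ν_compl_orthant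
  exact Measure.restrict_eq_self_of_ae_mem h

theorem exists_gaussian_law (x : EuclideanSpace ℝ (Fin d)) (t : ℝ≥0) :
    ∃ G : Measure (EuclideanSpace ℝ (Fin d)), IsProbabilityMeasure G ∧ ∀ ξ, charFun G ξ =
      Complex.exp (-((t : ℝ) : ℂ) *
        ∑ j, ((2 * p.c j * max (x j) 0 * ξ j ^ 2 : ℝ) : ℂ)) := by
  -- The coefficient 4 offsets the factor `1/2` in the Gaussian exponent.
  set S : Matrix (Fin d) (Fin d) ℝ := Matrix.diagonal fun j => 4 * p.c j * max (x j) 0 * t with hS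
  have hpos : S.PosSemidef := by
    refine Matrix.PosSemidef.diagonal fun j => ?_
    have h1 := p.c_nonneg j
    have h2 : 0 ≤ max (x j) 0 := le_max_right _ _
    change 0 ≤ 4 * p.c j * max (x j) 0 * (t : ℝ)
    positivity
  refine ⟨multivariateGaussian 0 S, inferInstance, fun ξ => ?_⟩
  rw [charFun_multivariateGaussian hpos]
  congr 1
  rw [inner_zero_right, hS]
  simp only [Matrix.mulVec_diagonal, dotProduct, Complex.ofReal_sum, Complex.ofReal_zero, zero_mul,
    zero_sub, Finset.mul_sum, Finset.sum_div, ← Finset.sum_neg_distrib]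
  refine Finset.sum_congr rfl fun j _ => ?_
  push_cast
  ring

/-- On the unit ball `min ‖z‖ (‖z‖ ^ 2)` is `‖z‖ ^ 2`, and the other terms of the moment condition
are nonnegative on the orthant. -/
theorem integrable_sq_norm_restrict (j : Fin d) :
    Integrable (fun z => ‖z‖ ^ 2) ((p.μ j).restrict {z | ‖z‖ ≤ 1}) := by
  have hS : MeasurableSet {z : EuclideanSpace ℝ (Fin d) | ‖z‖ ≤ 1} :=
    measurableSet_le measurable_norm measurable_const
  refine ((p.μ_integrable j).restrict (s := {z | ‖z‖ ≤ 1})).mono' (by fun_prop) ?_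
  filter_upwards [ae_restrict_mem hS, ae_restrict_of_ae (mem_ae_iff.2 (p.μ_compl_orthant j))]
    with z hz hzo
  have hz1 : ‖z‖ ≤ 1 := hz
  have h1 : ‖z‖ ^ 2 ≤ ‖z‖ := by nlinarith [norm_nonneg z]
  have h2 : 0 ≤ ∑ k ∈ Finset.univ.erase j, min 1 (z k) :=
    Finset.sum_nonneg fun k _ => le_min zero_le_one (hzo k)
  rw [Real.norm_of_nonneg (by positivity), min_eq_right h1]
  linarith

theorem exists_compensated_law (x : EuclideanSpace ℝ (Fin d)) (t : ℝ≥0) :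
    ∃ S : Measure (EuclideanSpace ℝ (Fin d)), IsProbabilityMeasure S ∧ ∀ ξ, charFun S ξ =
      Complex.exp (-((t : ℝ) : ℂ) * ∑ j, ((max (x j) 0 : ℝ) : ℂ) *
        ∫ z in {z | ‖z‖ ≤ 1},
          (1 + Complex.I * (inner ℝ ξ z : ℂ) - Complex.exp (Complex.I * (inner ℝ ξ z : ℂ))) ∂p.μ j) := by
  set κ : Fin d → Measure (EuclideanSpace ℝ (Fin d)) := fun j =>
    (t * (x j).toNNReal) • (p.μ j).restrict {z | ‖z‖ ≤ 1} with hκ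
  have hκint : ∀ j, Integrable (fun z => ‖z‖ ^ 2) (κ j) := fun j =>
    (integrable_sq_norm_restrict p j).smul_measure_nnreal
  have hsum : Integrable (fun z => ‖z‖ ^ 2) (∑ j, κ j) :=
    integrable_finsetSum_measure.2 fun j _ => hκint j
  obtain ⟨S, hS, hSchar⟩ := exists_compensated_infinitelyDivisible hsum
  refine ⟨S, hS, fun ξ => ?_⟩
  rw [hSchar, integral_finsetSum_measure, Finset.mul_sum]
  · congr 1
    refine Finset.sum_congr rfl fun j _ => ?_
    rw [hκ, integral_smul_nnreal_measure]
    have h1 : ∫ z in {z | ‖z‖ ≤ 1},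
        (Complex.exp (inner ℝ z ξ * Complex.I) - 1 - inner ℝ z ξ * Complex.I) ∂p.μ j =
        -∫ z in {z | ‖z‖ ≤ 1},
          (1 + Complex.I * (inner ℝ ξ z : ℂ) - Complex.exp (Complex.I * (inner ℝ ξ z : ℂ))) ∂p.μ j := by
      rw [← integral_neg]
      refine integral_congr_ae (Eventually.of_forall fun z => ?_)
      simp only [real_inner_comm ξ z, mul_comm Complex.I]
      ring
    rw [h1, NNReal.smul_def, Complex.real_smul, NNReal.coe_mul, Real.coe_toNNReal']
    push_cast
    ring
  · intro j _
    refine (hκint j |>.const_mul (3 * ‖ξ‖ ^ 2)).mono' (by fun_prop) (Eventually.of_forall fun z => ?_)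
    refine (norm_cexp_mul_I_sub_one_sub_le _).trans ?_
    have h1 : (inner ℝ z ξ) ^ 2 ≤ (‖z‖ * ‖ξ‖) ^ 2 := by
      rw [← sq_abs]
      exact pow_le_pow_left₀ (abs_nonneg _) (abs_real_inner_le_norm z ξ) 2
    nlinarith

/-- Assembling a density of the noise from a factorization of its jump part. -/
theorem exists_isNoiseDensity {q : EuclideanSpace ℝ (Fin d) → ℝ} (hq : Measurable q)
    (hq0 : ∀ z, 0 ≤ q z)
    [IsProbabilityMeasure (volume.withDensity fun z => ENNReal.ofReal (q z))]
    (S : Measure (EuclideanSpace ℝ (Fin d))) [IsProbabilityMeasure S] (t : ℝ≥0)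
    (hqS : ∀ ξ, charFun (volume.withDensity fun z => ENNReal.ofReal (q z)) ξ * charFun S ξ =
      Complex.exp (t * ∫ z, (BoundedContinuousFunction.innerProbChar ξ z - 1) ∂p.ν))
    (x : EuclideanSpace ℝ (Fin d)) :
    ∃ g : EuclideanSpace ℝ (Fin d) → ℝ, IsNoiseDensity.{u} p x t g ∧
      ∀ h, ∫ z, |g (z + h) - g z| ≤ ∫ z, |q (z + h) - q z| := by
  obtain ⟨G, hG, hGchar⟩ := exists_gaussian_law p x t
  obtain ⟨S', hS', hSchar'⟩ := exists_compensated_law p x t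
  obtain ⟨g, hgm, hg0, hgeq, hmod⟩ := exists_density_conv hq hq0 (S ∗ (G ∗ S'))
  have hprob : IsProbabilityMeasure (volume.withDensity fun z => ENNReal.ofReal (g z)) := by
    rw [← hgeq]
    infer_instance
  have hchar : ∀ ξ, charFun (volume.withDensity fun z => ENNReal.ofReal (g z)) ξ =
      Complex.exp (-((t : ℝ) : ℂ) * symbol p x ξ) := by
    intro ξ
    rw [← hgeq, charFun_conv, charFun_conv, charFun_conv, ← mul_assoc, hqS, hGchar, hSchar',
      ← Complex.exp_add, ← Complex.exp_add]
    congr 1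
    have h1 : ∫ z in orthant d, (1 - Complex.exp (Complex.I * (inner ℝ ξ z : ℂ))) ∂p.ν =
        -∫ z, (BoundedContinuousFunction.innerProbChar ξ z - 1) ∂p.ν := by
      rw [restrict_orthant_ν, ← integral_neg]
      refine integral_congr_ae (Eventually.of_forall fun z => ?_)
      simp only [BoundedContinuousFunction.innerProbChar_apply, real_inner_comm ξ z,
        mul_comm Complex.I]
      ring
    rw [symbol, h1]
    have h3 : ((t : ℝ≥0) : ℂ) = ((t : ℝ) : ℂ) := rfl
    rw [h3]
    ring
  -- No process has to be constructed: any process with this symbol has the same characteristic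
  -- function at time `t`, hence the same law.
  refine ⟨g, ⟨hgm, hg0, hprob, hchar, fun Ω _ P L hL => ?_⟩, hmod⟩
  have hP := hL.isLevyProcess.isProbabilityMeasure
  have hLm := hL.isLevyProcess.measurable t
  have hPL : IsProbabilityMeasure (P.map (L t)) := Measure.isProbabilityMeasure_map hLm.aemeasurable
  refine Measure.ext_of_charFun (funext fun ξ => ?_)
  rw [hchar, ← hL.charFun_eq t ξ, charFun_apply, integral_map hLm.aemeasurable (by fun_prop)]
  simp only [real_inner_comm ξ, mul_comm Complex.I]

end Noise

end CBI

theorem mainTheorem9 {d : ℕ} (p : CBI.AdmissibleParams d) (α : ℝ) (hα₀ : 0 < α) (hα₁ : α < 1)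
    (hν : ∃ c C R : ℝ, 0 < c ∧ 0 < C ∧ ∀ ξ : EuclideanSpace ℝ (Fin d), R ≤ ‖ξ‖ →
      c * ‖ξ‖ ^ α ≤ ∫ z in CBI.orthant d, (1 - Real.cos (inner ℝ ξ z)) ∂p.ν ∧
      ∫ z in CBI.orthant d, (1 - Real.cos (inner ℝ ξ z)) ∂p.ν ≤ C * ‖ξ‖ ^ α) :
    CBI.ConditionA.{u} p ∅ (fun _ => α) := by
  obtain ⟨c, C, R, hc, hC, hb⟩ := hν
  rw [CBI.restrict_orthant_ν] at hb
  obtain ⟨C', hC', t₀, ht₀, hfac⟩ := CBI.exists_density_factor p.ν_integrable p.ν_zero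
    p.ν_compl_orthant hα₀ hα₁ hc hC (fun ξ hξ => (hb ξ hξ).1) fun ξ hξ => (hb ξ hξ).2
  -- `C'` and `t₀` come from `ν` alone and are fixed before `x` is introduced.
  refine ⟨fun _ => ⟨hα₀, by linarith⟩, C', hC', t₀, ht₀, fun x hx t ht htt => ?_⟩
  obtain ⟨q, S, hqm, hq0, hqP, hS, hqS, hmod⟩ := hfac t ht htt
  obtain ⟨g, hg, hgmod⟩ := CBI.exists_isNoiseDensity.{u} p hqm hq0 S t hqS x
  refine ⟨g, hg, fun i h _ => ?_⟩
  have hrho : CBI.rho ∅ (fun _ => α) x = 1 := by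
    have hx0 : 0 < CBI.rho ∅ (fun _ => α) x := hx
    unfold CBI.rho at hx0 ⊢
    split_ifs at hx0 ⊢ with h1 h2
    · exact absurd h2 Finset.not_nonempty_empty
    · rfl
    · exact absurd hx0 (lt_irrefl 0)
  rw [hrho, div_one]
  refine (hgmod _).trans ((hmod i h).trans_eq ?_)
  ring
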